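/- Let $\mathcal D$ be a triangulated category (for instance, linear over a field). For a set $\mathcal X$ of objects put $\mathcal X^{\perp_{>0}}=\{Y\mid \mathrm{Hom}(X,Y[m])=0\ \forall X\in\mathcal X,\,m>0\}$, and define $\mathcal X^{\perp_{<0}}$ analogously. Let $\mathrm{ext}$ denote closure under extensions (including zero objects), let $\mathrm{Kar}(\mathcal X)$ be the class of direct summands of finite coproducts of objects of $\mathcal X$, and let $\mathrm{tria}$ and $\mathrm{thick}$ denote the triangulated, respectively thick, subcategory generated by a set of objects. A *silting collection* in $\mathcal D$ is a set $\mathcal P$ of indecomposable, pairwise non-isomorphic objects such that $\mathrm{Kar}(\mathcal P)$ is Krull–Schmidt and $(\mathcal P^{\perp_{>0}},\mathcal P^{\perp_{<0}})$ is a t-structure on $\mathcal D$ (the *silting t-structure* of $\mathcal P$). A *simple-minded collection* in $\mathcal D$ is a set $\mathcal L$ of objects such that $\mathrm{Hom}(L,L'[m])=0$ for all $L,L'\in\mathcal L$ and $m<0$; $\mathrm{Hom}(L,L')=0$ for $L\ne L'$ in $\mathcal L$; $\mathrm{End}(L)$ is a division ring for all $L\in\mathcal L$; and $\mathrm{tria}(\mathcal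 L)=\mathcal D$. Both collections may be infinite. A *weight structure* on a triangulated category $\mathcal C$ is a pair $(\mathcal C_{w\le0},\mathcal C_{w\ge0})$ of full subcategories closed under direct summands with $\mathcal C_{w\le 0}[1]\subseteq\mathcal C_{w\le 0}$, $\mathcal C_{w\ge 0}[-1]\subseteq\mathcal C_{w\ge 0}$, $\mathrm{Hom}(\mathcal C_{w>0},\mathcal C_{w\le0})=0$ where $\mathcal C_{w>0}=\mathcal C_{w\ge0}[-1]$, and such that every object $X$ fits in a distinguished triangle $A\to X\to B\to A[1]$ with $A\in\mathcal C_{w>0}$ and $B\in\mathcal C_{w\le0}$. Let $w$ be a weight structure on a thick subcategory $\mathcal C\subseteq\mathcal D$ and $t$ a t-structure on $\mathcal D$, with $\mathcal D^{t<0}=\mathcal D^{t\le0}[1]$ and $\mathcal D^{t>0}=\mathcal D^{t\ge0}[-1]$. Then $w$ is *left orthogonal* to $t$ if $\mathrm{Hom}_{\mathcal D}(\mathcal C_{w\ge0},\mathcal D^{t<0})=0$ and $\mathrm{Hom}_{\mathcal D}(\mathcal C_{w\le0},\mathcal D^{t>0})=0$. It is *w-t-strictly left orthogonal* to $t$ if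 moreover $\mathcal C_{w\ge0}={}^{\perp}(\mathcal D^{t<0})\cap\mathcal C$, $\mathcal C_{w\le0}={}^{\perp}(\mathcal D^{t>0})\cap\mathcal C$, $\mathcal D^{t<0}=(\mathcal C_{w\ge0})^{\perp}$ and $\mathcal D^{t>0}=(\mathcal C_{w\le0})^{\perp}$, the orthogonals being taken with respect to $\mathrm{Hom}_{\mathcal D}$. An object $P\in\mathcal D^{t\le0}$ is *derived projective* if $\mathrm{Hom}(P,X[1])=0$ for all $X\in\mathcal D^{t\le0}$. A *derived projective cover* of $X$ is a morphism $\pi\colon P\to X$ with $P$ derived projective such that $H^0_t(\pi)$ is a projective cover in the heart of $t$. **Theorem.** Let $\mathcal P$ be a silting collection and $\mathcal L$ a simple-minded collection in $\mathcal D$. Then $$\mathcal C_{w\le0}=\mathrm{Kar}_{\mathcal C}\,\mathrm{ext}_{\mathcal C}\{P[m]\mid P\in\mathcal P,\,m\ge0\},\qquad \mathcal C_{w\ge0}=\mathrm{Kar}_{\mathcal C}\,\mathrm{ext}_{\mathcal C}\{P[m]\mid P\in\mathcal P,\,m\le0\}$$ define a weight structure $w$ on $\mathcal C=\mathrm{thick}_{\mathcal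 D}(\mathcal P)$, $$\mathcal D^{t\le0}=\mathrm{ext}_{\mathcal D}\{L[m]\mid L\in\mathcal L,\,m\ge0\},\qquad \mathcal D^{t\ge0}=\mathrm{ext}_{\mathcal D}\{L[m]\mid L\in\mathcal L,\,m\le0\}$$ define a t-structure $t$ on $\mathcal D$, and the following are equivalent: 1. $w$ is left orthogonal to $t$. 2. $w$ is w-t-strictly left orthogonal to $t$. 3. $t=(\mathcal P^{\perp_{>0}},\mathcal P^{\perp_{<0}})$ is the silting t-structure associated with $\mathcal P$. 4. There is a bijection $\phi\colon\mathcal P\to\mathcal L$ such that every $P\in\mathcal P$ is the derived projective cover (with respect to $t$) of $\phi(P)$. 5. There is a bijection $\phi\colon\mathcal P\to\mathcal L$ such that for all $P\in\mathcal P$, $L\in\mathcal L$ and $m\in\mathbb Z$ there are isomorphisms of left $\mathrm{End}_{\mathcal D}(L)$-modules $$\mathrm{Hom}_{\mathcal D}(P,L[m])\cong\begin{cases}\mathrm{End}_{\mathcal D}(L)&\text{if }L=\phi(P),\ m=0,\\0&\text{otherwise.}\end{cases}$$ -/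

import Mathlib

open CategoryTheory CategoryTheory.Limits CategoryTheory.Pretriangulated
open CategoryTheory.Triangulated ZeroObject

universe v u

noncomputable section

namespace SiltingTheory

/-! ### Closure operations on classes of objects -/

section Closures

variable {C : Type u} [Category.{v} C] [Preadditive C] [HasZeroObject C] [HasShift C ℤ]
  [∀ n : ℤ, (shiftFunctor C n).Additive] [Pretriangulated C]

/-- The objects isomorphic to a shift `S⟦m⟧` with `S ∈ 𝒮` and `m` satisfying `p`. -/
def shiftsOf (𝒮 : Set C) (p : ℤ → Prop) : ObjectProperty C :=
  fun X => ∃ S ∈ 𝒮, ∃ m : ℤ, p m ∧ Nonempty (X ≅ S⟦m⟧)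

/-- The extension closure of `Q`: the smallest class of objects that contains `Q` and the zero
objects and is closed under extensions. (Closure under isomorphisms is automatic, by the
triangles `X ⟶ Y ⟶ 0 ⟶ X⟦1⟧` with `X ≅ Y`. The zero objects only matter if `Q` is empty.) -/
inductive extClosure (Q : ObjectProperty C) : ObjectProperty C
  | of (X : C) (hX : Q X) : extClosure Q X
  | zero (X : C) (hX : IsZero X) : extClosure Q X
  | ext (T : Triangle C) (hT : T ∈ distTriang C) (h₁ : extClosure Q T.obj₁)
      (h₃ : extClosure Q T.obj₃) : extClosure Q T.obj₂

/-- The triangulated subcategory generated by `𝒮`: the smallest strict full subcategory that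
contains `𝒮` and the zero objects and is closed under all shifts and under extensions
(hence under cones). -/
inductive tria (𝒮 : Set C) : ObjectProperty C
  | of (X : C) (hX : X ∈ 𝒮) : tria 𝒮 X
  | zero (X : C) (hX : IsZero X) : tria 𝒮 X
  | shift (X : C) (n : ℤ) (hX : tria 𝒮 X) : tria 𝒮 (X⟦n⟧)
  | ext (T : Triangle C) (hT : T ∈ distTriang C) (h₁ : tria 𝒮 T.obj₁)
      (h₃ : tria 𝒮 T.obj₃) : tria 𝒮 T.obj₂

/-- The thick subcategory generated by `𝒮`: as `tria`, and moreover closed under direct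
summands. -/
inductive thick (𝒮 : Set C) : ObjectProperty C
  | of (X : C) (hX : X ∈ 𝒮) : thick 𝒮 X
  | zero (X : C) (hX : IsZero X) : thick 𝒮 X
  | shift (X : C) (n : ℤ) (hX : thick 𝒮 X) : thick 𝒮 (X⟦n⟧)
  | ext (T : Triangle C) (hT : T ∈ distTriang C) (h₁ : thick 𝒮 T.obj₁)
      (h₃ : thick 𝒮 T.obj₃) : thick 𝒮 T.obj₂
  | retract (X Y : C) (r : Retract X Y) (hY : thick 𝒮 Y) : thick 𝒮 X

instance thick_isStableUnderRetracts (𝒮 : Set C) : (thick 𝒮).IsStableUnderRetracts where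
  of_retract r h := thick.retract _ _ r h

instance thick_isTriangulated (𝒮 : Set C) : (thick 𝒮).IsTriangulated where
  exists_zero := ⟨0, isZero_zero C, thick.zero _ (isZero_zero C)⟩
  isStableUnderShiftBy n := { le_shift := fun X hX => thick.shift X n hX }
  toIsTriangulatedClosed₂ := .mk' fun T hT h₁ h₃ => thick.ext T hT h₁ h₃

/-- `Kar Q`: the direct summands of finite coproducts of objects in `Q`. -/
def Kar (Q : ObjectProperty C) : ObjectProperty C :=
  fun X => ∃ (n : ℕ) (Y : Fin n → C), (∀ i, Q (Y i)) ∧ Nonempty (Retract X (⨁ Y))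

/-- A full additive subcategory is Krull–Schmidt if each of its objects is a finite direct sum
of objects of the subcategory that have local endomorphism rings. -/
def IsKrullSchmidt (Q : ObjectProperty C) : Prop :=
  ∀ X, Q X → ∃ (n : ℕ) (Y : Fin n → C),
    (∀ i, Q (Y i) ∧ IsLocalRing (End (Y i))) ∧ Nonempty (X ≅ ⨁ Y)

/-- `𝒮^{⊥_{>0}}`. -/
def perpPos (𝒮 : Set C) : ObjectProperty C :=
  fun X => ∀ S ∈ 𝒮, ∀ m : ℤ, 0 < m → ∀ f : S ⟶ X⟦m⟧, f = 0

/-- `𝒮^{⊥_{<0}}`. -/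
def perpNeg (𝒮 : Set C) : ObjectProperty C :=
  fun X => ∀ S ∈ 𝒮, ∀ m : ℤ, m < 0 → ∀ f : S ⟶ X⟦m⟧, f = 0

end Closures

/-! ### Weight structures -/

section Weight

variable (C : Type u) [Category.{v} C] [Preadditive C] [HasZeroObject C] [HasShift C ℤ]
  [∀ n : ℤ, (shiftFunctor C n).Additive] [Pretriangulated C]

/-- A weight structure `(C_{w ≤ 0}, C_{w ≥ 0})`. An object `X` lies in
`C_{w > 0} = C_{w ≥ 0}⟦-1⟧` if and only if `X⟦1⟧` lies in `C_{w ≥ 0}`. -/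
structure WeightStructure where
  /-- the class `C_{w ≤ 0}` -/
  le : ObjectProperty C
  /-- the class `C_{w ≥ 0}` -/
  ge : ObjectProperty C
  le_retracts : le.IsStableUnderRetracts
  ge_retracts : ge.IsStableUnderRetracts
  le_shift : ∀ X : C, le X → le (X⟦(1 : ℤ)⟧)
  ge_shift : ∀ X : C, ge X → ge (X⟦(-1 : ℤ)⟧)
  hom_eq_zero : ∀ (X Y : C) (f : X ⟶ Y), ge (X⟦(1 : ℤ)⟧) → le Y → f = 0
  exists_triangle : ∀ X : C, ∃ (A B : C) (f : A ⟶ X) (g : X ⟶ B) (h : B ⟶ A⟦(1 : ℤ)⟧),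
    Triangle.mk f g h ∈ distTriang C ∧ ge (A⟦(1 : ℤ)⟧) ∧ le B

end Weight

section Main

variable {D : Type u} [Category.{v} D] [Preadditive D] [HasZeroObject D] [HasShift D ℤ]
  [∀ n : ℤ, (shiftFunctor D n).Additive] [Pretriangulated D]

/-! ### Silting collections and simple-minded collections -/

/-- `t` is the pair `(𝓟^{⊥_{>0}}, 𝓟^{⊥_{<0}})`. -/
def IsSiltingTStructure (𝓟 : Set D) (t : TStructure D) : Prop :=
  t.le 0 = perpPos 𝓟 ∧ t.ge 0 = perpNeg 𝓟

/-- Silting collections in `D`. -/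
structure IsSiltingCollection (𝓟 : Set D) : Prop where
  krullSchmidt : IsKrullSchmidt (Kar (fun X : D => X ∈ 𝓟))
  indecomposable : ∀ P ∈ 𝓟, Indecomposable P
  pairwise_not_iso : ∀ P ∈ 𝓟, ∀ P' ∈ 𝓟, Nonempty (P ≅ P') → P = P'
  exists_tStructure : ∃ t : TStructure D, IsSiltingTStructure 𝓟 t

/-- Simple-minded collections in `D`. -/
structure IsSimpleMindedCollection (𝓛 : Set D) : Prop where
  hom_neg : ∀ L ∈ 𝓛, ∀ L' ∈ 𝓛, ∀ m : ℤ, m < 0 → ∀ f : L ⟶ L'⟦m⟧, f = 0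
  hom_ne : ∀ L ∈ 𝓛, ∀ L' ∈ 𝓛, L ≠ L' → ∀ f : L ⟶ L', f = 0
  /-- `End L` is a division ring -/
  division : ∀ L ∈ 𝓛, Nontrivial (End L) ∧ ∀ f : End L, f ≠ 0 → IsUnit f
  generates : ∀ X : D, tria 𝓛 X

/-- `w` is the weight structure on `thick 𝓟` defined by `𝓟`, that is
`C_{w ≤ 0} = Kar ext {P⟦m⟧ | P ∈ 𝓟, m ≥ 0}` and `C_{w ≥ 0} = Kar ext {P⟦m⟧ | P ∈ 𝓟, m ≤ 0}`,
the closures being taken in the triangulated category `C = thick 𝓟`. -/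
def IsWeightStructureOf (𝓟 : Set D) (w : WeightStructure (thick 𝓟).FullSubcategory) : Prop :=
  w.le = Kar (extClosure (shiftsOf {X : (thick 𝓟).FullSubcategory | X.obj ∈ 𝓟} (0 ≤ ·))) ∧
  w.ge = Kar (extClosure (shiftsOf {X : (thick 𝓟).FullSubcategory | X.obj ∈ 𝓟} (· ≤ 0)))

/-- `t` is the t-structure on `D` defined by `𝓛`, that is
`D^{t ≤ 0} = ext {L⟦m⟧ | L ∈ 𝓛, m ≥ 0}` and `D^{t ≥ 0} = ext {L⟦m⟧ | L ∈ 𝓛, m ≤ 0}`. -/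
def IsTStructureOf (𝓛 : Set D) (t : TStructure D) : Prop :=
  t.le 0 = extClosure (shiftsOf 𝓛 (0 ≤ ·)) ∧ t.ge 0 = extClosure (shiftsOf 𝓛 (· ≤ 0))

/-! ### Orthogonality, with respect to `Hom_D`

Here `D^{t < 0} = D^{t ≤ -1}` is `t.le (-1)` and `D^{t > 0} = D^{t ≥ 1}` is `t.ge 1`. -/

section Orthogonality

variable {𝒞 : ObjectProperty D} [𝒞.IsTriangulated] (w : WeightStructure 𝒞.FullSubcategory)
  (t : TStructure D)

/-- `w` is left orthogonal to `t`: `C_{w ≥ 0} ⊥ D^{t < 0}` and `C_{w ≤ 0} ⊥ D^{t > 0}`. -/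
structure IsLeftOrthogonal : Prop where
  ge_perp : ∀ (X : 𝒞.FullSubcategory) (Y : D), w.ge X → t.le (-1) Y →
    ∀ f : X.obj ⟶ Y, f = 0
  le_perp : ∀ (X : 𝒞.FullSubcategory) (Y : D), w.le X → t.ge 1 Y →
    ∀ f : X.obj ⟶ Y, f = 0

/-- w-strictness: `C_{w ≥ 0} = ^⊥(D^{t < 0})` and `C_{w ≤ 0} = ^⊥(D^{t > 0})`. -/
structure IsWStrict : Prop where
  ge_iff : ∀ X : 𝒞.FullSubcategory,
    w.ge X ↔ ∀ Y : D, t.le (-1) Y → ∀ f : X.obj ⟶ Y, f = 0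
  le_iff : ∀ X : 𝒞.FullSubcategory,
    w.le X ↔ ∀ Y : D, t.ge 1 Y → ∀ f : X.obj ⟶ Y, f = 0

/-- t-strictness: `D^{t < 0} = (C_{w ≥ 0})^⊥` and `D^{t > 0} = (C_{w ≤ 0})^⊥`. -/
structure IsTStrict : Prop where
  lt_iff : ∀ Y : D,
    t.le (-1) Y ↔ ∀ X : 𝒞.FullSubcategory, w.ge X → ∀ f : X.obj ⟶ Y, f = 0
  gt_iff : ∀ Y : D,
    t.ge 1 Y ↔ ∀ X : 𝒞.FullSubcategory, w.le X → ∀ f : X.obj ⟶ Y, f = 0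

/-- `w` is w-t-strictly left orthogonal to `t`. -/
def IsWTStrictlyLeftOrthogonal : Prop :=
  IsLeftOrthogonal w t ∧ IsWStrict w t ∧ IsTStrict w t

end Orthogonality

/-! ### Derived projective covers -/

/-- A projective cover: an epimorphism `π : P ⟶ X` with `P` projective that is essential
(its kernel is superfluous). -/
structure IsProjectiveCover {A : Type u} [Category.{v} A] {P X : A} (π : P ⟶ X) : Prop where
  projective : Projective P
  epi : Epi π
  essential : ∀ (Q : A) (g : Q ⟶ P), Epi (g ≫ π) → Epi g

/-- `P` is derived projective with respect to `t`. -/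
structure IsDerivedProjective (t : TStructure D) (P : D) : Prop where
  le_zero : t.le 0 P
  hom_eq_zero : ∀ X : D, t.le 0 X → ∀ f : P ⟶ X⟦(1 : ℤ)⟧, f = 0

variable [IsTriangulated D]

/-- The cohomology functor `H_t^0 = t_{≥ 0} t_{≤ 0}` from `D` to the heart of `t`. -/
def heartCohomology (t : TStructure D) : D ⥤ t.heart.FullSubcategory :=
  t.heart.lift (t.truncGELT 0 1) fun X =>
    (t.mem_heart_iff _).2
      ⟨by have := t.isLE_truncLT_obj X 1 0
          exact inferInstanceAs (t.IsLE ((t.truncGE 0).obj ((t.truncLT 1).obj X)) 0),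
        inferInstance⟩

/-- `π : P ⟶ X` is a derived projective cover of `X` with respect to `t`. -/
structure IsDerivedProjectiveCover (t : TStructure D) {P X : D} (π : P ⟶ X) : Prop where
  derivedProjective : IsDerivedProjective t P
  projectiveCover : IsProjectiveCover ((heartCohomology t).map π)

/-- Under the bijection `φ`, each `P ∈ 𝓟` is the derived projective cover of `φ P`. -/
def IsDerivedProjectiveCoverBijection (t : TStructure D) {𝓟 𝓛 : Set D} (φ : 𝓟 ≃ 𝓛) : Prop :=
  ∀ P : 𝓟, ∃ π : P.1 ⟶ (φ P).1, IsDerivedProjectiveCover t π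

/-- `Hom(P, L⟦m⟧) ≅ End L` as left `End L`-modules if `L = φ P` and `m = 0`, and
`Hom(P, L⟦m⟧) = 0` otherwise. The ring `End L` acts on `Hom(P, L)` by composition. -/
def IsHomDualBijection {𝓟 𝓛 : Set D} (φ : 𝓟 ≃ 𝓛) : Prop :=
  (∀ P : 𝓟, Nonempty ((P.1 ⟶ (φ P).1) ≃ₗ[End (φ P).1] End (φ P).1)) ∧
  ∀ (P : 𝓟) (L : 𝓛) (m : ℤ), ¬(L = φ P ∧ m = 0) → ∀ f : P.1 ⟶ L.1⟦m⟧, f = 0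

end Main

end SiltingTheory

end

set_option linter.unusedSectionVars false

namespace SiltingTheory

open ObjectProperty

section General

variable {C : Type u} [Category.{v} C] [Preadditive C] [HasZeroObject C] [HasShift C ℤ]
  [∀ n : ℤ, (shiftFunctor C n).Additive] [Pretriangulated C]

/-! ### Morphisms between shifts -/

/-! Both structures come from reordering extensions. Since `𝓟` lies in the aisle of its own silting
t-structure, `Hom(P, Q⟦m⟧) = 0` for `m > 0`. An extension in the wrong order of the two weight
classes therefore splits and can be swapped, so the objects with a weight decomposition are closed
under extensions; an induction on boundedness adds summands
(`extensionProduct_weightPart_of_retract`). For `𝓛`, a connecting morphism between generators in the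
wrong order is zero or invertible, so the extension splits or vanishes
(`IsSimpleMindedCollection.extensionProduct_le`).

Condition 3 is the hub of the equivalences. Conditions 1, 4 and 5 each make every `P ∈ 𝓟` derived
projective for `t`. This puts both halves of `t` inside those of the silting t-structure, and two
t-structures nested in this way are equal (`isSiltingTStructure_of_isDerivedProjective`).
Conversely, 3 gives 2 by testing `t` on shifts of `𝓟` and by splitting weight decompositions.

For 3 ⇒ 4 and 3 ⇒ 5, the cone of a nonzero morphism from `D^{t ≤ 0}` to a simple `L` lies in `D^{t ≤
-1}` (`cone_le`), so derived projectives lift along it. As `End P` is local, a nonzero `P ⟶ L` then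
factors every morphism from `P` to a simple object (`exists_factor`). This yields the bijection, the
Hom formula and, in the heart, the projective covers. -/

lemma hom_shift_eq_zero {X Y : C} {a b c : ℤ} (h : c + a = b) (H : ∀ f : X ⟶ Y⟦c⟧, f = 0)
    (f : X⟦a⟧ ⟶ Y⟦b⟧) : f = 0 := by
  obtain ⟨g, hg⟩ := (shiftFunctor C a).map_surjective
    (f ≫ (shiftFunctorAdd' C c a b h).hom.app Y)
  rw [H g, Functor.map_zero] at hg
  rw [← cancel_mono ((shiftFunctorAdd' C c a b h).hom.app Y), ← hg, zero_comp]

lemma eq_zero_of_hom_shift_eq_zero {X Y : C} {a b c : ℤ} (h : c + a = b)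
    (H : ∀ f : X⟦a⟧ ⟶ Y⟦b⟧, f = 0) (f : X ⟶ Y⟦c⟧) : f = 0 := by
  apply (shiftFunctor C a).map_injective
  rw [Functor.map_zero, ← cancel_mono ((shiftFunctorAdd' C c a b h).inv.app Y), zero_comp]
  exact H _

lemma hom_eq_zero_of_iso {X X' Y Y' : C} (e : X ≅ X') (e' : Y ≅ Y')
    (H : ∀ f : X' ⟶ Y', f = 0) (f : X ⟶ Y) : f = 0 := by
  have := H (e.inv ≫ f ≫ e'.hom)
  simpa using this

lemma leftOrthogonal_isStableUnderRetracts (P : ObjectProperty C) :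
    P.leftOrthogonal.IsStableUnderRetracts where
  of_retract r h Y f hY := by
    have := h (r.r ≫ f) hY
    rw [← Category.id_comp f, ← r.retract, Category.assoc, this, comp_zero]

lemma rightOrthogonal_isStableUnderRetracts (P : ObjectProperty C) :
    P.rightOrthogonal.IsStableUnderRetracts where
  of_retract r h Y f hY := by
    have := h (f ≫ r.i) hY
    rw [← Category.comp_id f, ← r.retract, ← Category.assoc, this, zero_comp]

attribute [instance] leftOrthogonal_isStableUnderRetracts rightOrthogonal_isStableUnderRetracts

/-! ### Extension closures -/

instance extClosure_isClosedUnderIsomorphisms (Q : ObjectProperty C) :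
    (extClosure Q).IsClosedUnderIsomorphisms where
  of_iso {X Y} e hX := by
    refine extClosure.ext (Triangle.mk e.hom (0 : Y ⟶ 0) 0) ?_ hX
      (extClosure.zero _ (isZero_zero C))
    exact (Triangle.distinguished_iff_of_isZero₃ _ (isZero_zero C)).2 (inferInstanceAs (IsIso e.hom))

instance extClosure_containsZero (Q : ObjectProperty C) : (extClosure Q).ContainsZero where
  exists_zero := ⟨0, isZero_zero C, extClosure.zero _ (isZero_zero C)⟩

instance extClosure_isTriangulatedClosed₂ (Q : ObjectProperty C) :
    (extClosure Q).IsTriangulatedClosed₂ :=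
  .mk' fun T hT h₁ h₃ => extClosure.ext T hT h₁ h₃

lemma extClosure_le {Q R : ObjectProperty C} [R.IsClosedUnderIsomorphisms] [R.ContainsZero]
    [R.IsTriangulatedClosed₂] (h : Q ≤ R) : extClosure Q ≤ R := by
  intro X hX
  induction hX with
  | of X hX => exact h X hX
  | zero X hX => exact R.prop_of_isZero hX
  | ext T hT _ _ h₁ h₃ => exact R.ext_of_isTriangulatedClosed₂ T hT h₁ h₃

lemma le_extClosure (Q : ObjectProperty C) : Q ≤ extClosure Q := fun X hX => .of X hX

lemma isClosedUnderFiniteProducts_of_isTriangulatedClosed₂ (P : ObjectProperty C)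
    [P.IsClosedUnderIsomorphisms] [P.ContainsZero] [P.IsTriangulatedClosed₂] :
    P.IsClosedUnderFiniteProducts := by
  have : P.IsClosedUnderBinaryProducts :=
    { limitsOfShape_le := by
        rintro X ⟨p⟩
        exact P.prop_of_iso ((limit.isLimit _).conePointUniqueUpToIso p.isLimit ≪≫ Iso.refl _)
          (P.prop_of_iso (HasLimit.isoOfNatIso (diagramIsoPair p.diag)).symm
            (P.ext_of_isTriangulatedClosed₂ _ (binaryProductTriangle_distinguished _ _)
          (p.prop_diag_obj (.mk .left)) (p.prop_diag_obj (.mk .right)))) }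
  exact .mk'

lemma Kar_eq_retractClosure (P : ObjectProperty C)
    [P.IsClosedUnderIsomorphisms] [P.ContainsZero] [P.IsTriangulatedClosed₂] :
    Kar P = P.retractClosure := by
  have := isClosedUnderFiniteProducts_of_isTriangulatedClosed₂ P
  ext X
  constructor
  · rintro ⟨n, Y, hY, ⟨r⟩⟩
    exact ⟨⨁ Y, P.prop_of_iso (biproduct.isoProduct Y).symm (P.prop_product hY), ⟨r⟩⟩
  · rintro ⟨Y, hY, ⟨r⟩⟩
    exact ⟨1, fun _ => Y, fun _ => hY,
      ⟨r.trans ⟨biproduct.ι (fun _ : Fin 1 => Y) 0, biproduct.π (fun _ : Fin 1 => Y) 0, by simp⟩⟩⟩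

lemma retractClosure_isTriangulatedClosed₂ (P : ObjectProperty C)
    [P.IsClosedUnderIsomorphisms] [P.IsTriangulatedClosed₂] :
    P.retractClosure.IsTriangulatedClosed₂ :=
  .mk' fun T hT h₁ h₃ => by
    obtain ⟨Y, hY, r⟩ := extensionProduct_retractClosure_retractClosure_le P P _
      ⟨_, _, _, _, _, hT, h₁, h₃⟩
    exact ⟨Y, extensionProduct_le_of_isTriangulatedClosed₂ le_rfl le_rfl _ hY, r⟩

/-! ### Extension products -/

lemma extensionProduct_of_distTriang {P Q : ObjectProperty C} (T : Triangle C)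
    (hT : T ∈ distTriang C) (h₁ : P T.obj₁) (h₃ : Q T.obj₃) : extensionProduct P Q T.obj₂ :=
  ⟨_, _, _, _, _, hT, h₁, h₃⟩

/-- A split extension can be taken in the opposite order. -/
lemma extensionProduct_swap_of_mor₃_eq_zero {P Q : ObjectProperty C} (T : Triangle C)
    (hT : T ∈ distTriang C) (h₁ : P T.obj₁) (h₃ : Q T.obj₃) (h : T.mor₃ = 0) :
    extensionProduct Q P T.obj₂ := by
  obtain ⟨e, -⟩ := exists_iso_binaryBiproduct_of_distTriang T hT h
  exact (extensionProduct Q P).prop_of_iso (e ≪≫ biprod.braiding _ _).symm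
    (extensionProduct_of_distTriang _ (binaryBiproductTriangle_distinguished _ _) h₃ h₁)

/-- By associativity, `(P * Q) * (P * Q) = P * (Q * P) * Q ≤ P * (P * Q) * Q = (P * P) * (Q * Q) ≤ P
* Q`. -/
lemma extensionProduct_isTriangulatedClosed₂ [IsTriangulated C] {P Q : ObjectProperty C}
    [P.IsClosedUnderIsomorphisms] [P.IsTriangulatedClosed₂]
    [Q.IsClosedUnderIsomorphisms] [Q.IsTriangulatedClosed₂]
    (h : extensionProduct Q P ≤ extensionProduct P Q) :
    (extensionProduct P Q).IsTriangulatedClosed₂ :=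
  .mk' fun T hT h₁ h₃ => by
    have hP : extensionProduct P P ≤ P :=
      extensionProduct_le_of_isTriangulatedClosed₂ le_rfl le_rfl
    have hQ : extensionProduct Q Q ≤ Q :=
      extensionProduct_le_of_isTriangulatedClosed₂ le_rfl le_rfl
    have key : extensionProduct (extensionProduct P Q) (extensionProduct P Q) ≤
        extensionProduct P Q := by
      rw [extensionProduct_assoc, ← extensionProduct_assoc Q]
      refine (monotone_extensionProduct_right _ (monotone_extensionProduct_left _ h)).trans ?_
      rw [extensionProduct_assoc, ← extensionProduct_assoc P]
      exact (monotone_extensionProduct_left _ hP).trans (monotone_extensionProduct_right _ hQ)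
    exact key _ (extensionProduct_of_distTriang T hT h₁ h₃)

/-- Associativity moves `R` past one generator at a time, so swapping need only be checked on
generators. `R` itself need not be closed under extensions. -/
lemma extensionProduct_extClosure_le_of_right [IsTriangulated C] {Q R : ObjectProperty C}
    [R.ContainsZero] [R.IsClosedUnderIsomorphisms]
    (h : extensionProduct R Q ≤ extensionProduct (extClosure Q) R) :
    extensionProduct R (extClosure Q) ≤ extensionProduct (extClosure Q) R := by
  rintro X ⟨Y, Z, f, g, k, hT, hY, hZ⟩
  induction hZ generalizing X Y with
  | of Z hZ => exact h X ⟨_, _, _, _, _, hT, hY, hZ⟩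
  | zero Z hZ =>
    have : IsIso f := ((Triangle.mk f g k).isZero₃_iff_isIso₁ hT).1 hZ
    exact le_extensionProduct_right _ _ (R.prop_of_iso (asIso f) hY)
  | ext T hT' _ _ h₁ h₃ =>
    have h₁' : extensionProduct R (· = T.obj₁) ≤ extensionProduct (extClosure Q) R := by
      rintro X ⟨Y, _, f, g, k, hT, hY, rfl⟩
      exact h₁ _ _ _ _ _ hT hY
    have h₃' : extensionProduct R (· = T.obj₃) ≤ extensionProduct (extClosure Q) R := by
      rintro X ⟨Y, _, f, g, k, hT, hY, rfl⟩
      exact h₃ _ _ _ _ _ hT hY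
    have : extensionProduct R (extensionProduct (· = T.obj₁) (· = T.obj₃)) X :=
      ⟨_, _, _, _, _, hT, hY, extensionProduct_of_distTriang T hT' rfl rfl⟩
    rw [← extensionProduct_assoc] at this
    have := monotone_extensionProduct_left _ h₁' _ this
    rw [extensionProduct_assoc] at this
    have := monotone_extensionProduct_right _ h₃' _ this
    rw [← extensionProduct_assoc] at this
    exact monotone_extensionProduct_left _
      (extensionProduct_le_of_isTriangulatedClosed₂ le_rfl le_rfl) _ this

lemma extensionProduct_extClosure_le_of_left [IsTriangulated C] {Q R : ObjectProperty C}
    [R.ContainsZero] [R.IsClosedUnderIsomorphisms]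
    (h : extensionProduct Q R ≤ extensionProduct R (extClosure Q)) :
    extensionProduct (extClosure Q) R ≤ extensionProduct R (extClosure Q) := by
  rintro X ⟨Y, Z, f, g, k, hT, hY, hZ⟩
  induction hY generalizing X Z with
  | of Y hY => exact h X ⟨_, _, _, _, _, hT, hY, hZ⟩
  | zero Y hY =>
    have : IsIso g := ((Triangle.mk f g k).isZero₁_iff_isIso₂ hT).1 hY
    exact le_extensionProduct_left _ _ (R.prop_of_iso (asIso g).symm hZ)
  | ext T hT' _ _ h₁ h₃ =>
    have h₁' : extensionProduct (· = T.obj₁) R ≤ extensionProduct R (extClosure Q) := by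
      rintro X ⟨_, Z, f, g, k, hT, rfl, hZ⟩
      exact h₁ _ _ _ _ _ hT hZ
    have h₃' : extensionProduct (· = T.obj₃) R ≤ extensionProduct R (extClosure Q) := by
      rintro X ⟨_, Z, f, g, k, hT, rfl, hZ⟩
      exact h₃ _ _ _ _ _ hT hZ
    have : extensionProduct (extensionProduct (· = T.obj₁) (· = T.obj₃)) R X :=
      ⟨_, _, _, _, _, hT, extensionProduct_of_distTriang T hT' rfl rfl, hZ⟩
    rw [extensionProduct_assoc] at this
    have := monotone_extensionProduct_right _ h₃' _ this
    rw [← extensionProduct_assoc] at this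
    have := monotone_extensionProduct_left _ h₁' _ this
    rw [extensionProduct_assoc] at this
    exact monotone_extensionProduct_right _
      (extensionProduct_le_of_isTriangulatedClosed₂ le_rfl le_rfl) _ this

/-! ### Extension closures of shifts -/

lemma shiftsOf_mono {𝒮 : Set C} {p q : ℤ → Prop} (h : ∀ m, p m → q m) :
    shiftsOf 𝒮 p ≤ shiftsOf 𝒮 q :=
  fun _ ⟨S, hS, m, hm, e⟩ => ⟨S, hS, m, h m hm, e⟩

lemma extClosure_mono {Q R : ObjectProperty C} (h : Q ≤ R) : extClosure Q ≤ extClosure R :=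
  extClosure_le (h.trans (le_extClosure R))

lemma extClosure_shiftsOf_of_mem {𝒮 : Set C} {p : ℤ → Prop} {S : C} (hS : S ∈ 𝒮)
    {m : ℤ} (hm : p m) : extClosure (shiftsOf 𝒮 p) (S⟦m⟧) :=
  .of _ ⟨S, hS, m, hm, ⟨Iso.refl _⟩⟩

lemma extClosure_shiftsOf_self {𝒮 : Set C} {p : ℤ → Prop} {S : C} (hS : S ∈ 𝒮)
    (hp : p 0) : extClosure (shiftsOf 𝒮 p) S :=
  .of _ ⟨S, hS, 0, hp, ⟨((shiftFunctorZero C ℤ).app S).symm⟩⟩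

lemma extClosure_shiftsOf_shift {𝒮 : Set C} {p q : ℤ → Prop} (n : ℤ)
    (h : ∀ m, p m → q (m + n)) {X : C} (hX : extClosure (shiftsOf 𝒮 p) X) :
    extClosure (shiftsOf 𝒮 q) (X⟦n⟧) := by
  induction hX with
  | of X hX =>
    obtain ⟨S, hS, m, hm, ⟨e⟩⟩ := hX
    exact .of _ ⟨S, hS, m + n, h m hm,
      ⟨(shiftFunctor C n).mapIso e ≪≫ (shiftFunctorAdd C m n).symm.app S⟩⟩
  | zero X hX => exact .zero _ ((shiftFunctor C n).map_isZero hX)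
  | ext T hT _ _ h₁ h₃ => exact .ext _ (T.shift_distinguished hT n) h₁ h₃

lemma extClosure_le_leftOrthogonal {Q R : ObjectProperty C}
    (h : ∀ X Y, Q X → R Y → ∀ f : X ⟶ Y, f = 0) :
    extClosure Q ≤ (extClosure R).leftOrthogonal := by
  have h' : extClosure R ≤ Q.rightOrthogonal := extClosure_le fun Y hY X f hX => h X Y hX hY f
  exact extClosure_le fun X hX Y f hY => h' _ hY f hX

lemma hom_extClosure_shiftsOf {𝒮 𝒯 : Set C} {p q : ℤ → Prop}
    (h : ∀ S ∈ 𝒮, ∀ T ∈ 𝒯, ∀ a b, p a → q b → ∀ f : S ⟶ T⟦b - a⟧, f = 0)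
    {X Y : C} (hX : extClosure (shiftsOf 𝒮 p) X) (hY : extClosure (shiftsOf 𝒯 q) Y)
    (f : X ⟶ Y) : f = 0 := by
  refine extClosure_le_leftOrthogonal ?_ _ hX f hY
  rintro X Y ⟨S, hS, a, ha, ⟨e⟩⟩ ⟨T, hT, b, hb, ⟨e'⟩⟩
  exact hom_eq_zero_of_iso e e' (hom_shift_eq_zero (by lia) (h S hS T hT a b ha hb))

end General

section Weight

variable {C : Type u} [Category.{v} C] [Preadditive C] [HasZeroObject C] [HasShift C ℤ]
  [∀ n : ℤ, (shiftFunctor C n).Additive] [Pretriangulated C]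

/-! ### The weight structure of a negative collection of generators -/

/-- The retract closure of the extension closure of the shifts `S⟦m⟧` with `p m`. -/
abbrev weightPart (𝒮 : Set C) (p : ℤ → Prop) : ObjectProperty C :=
  (extClosure (shiftsOf 𝒮 p)).retractClosure

instance weightPart_isTriangulatedClosed₂ (𝒮 : Set C) (p : ℤ → Prop) :
    (weightPart 𝒮 p).IsTriangulatedClosed₂ :=
  retractClosure_isTriangulatedClosed₂ _

instance weightPart_containsZero (𝒮 : Set C) (p : ℤ → Prop) :
    (weightPart 𝒮 p).ContainsZero where
  exists_zero := ⟨0, isZero_zero C, le_retractClosure _ _ (.zero _ (isZero_zero C))⟩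

lemma weightPart_shift {𝒮 : Set C} {p q : ℤ → Prop} (n : ℤ)
    (h : ∀ m, p m → q (m + n)) {X : C} (hX : weightPart 𝒮 p X) : weightPart 𝒮 q (X⟦n⟧) := by
  obtain ⟨Y, hY, ⟨r⟩⟩ := hX
  exact ⟨_, extClosure_shiftsOf_shift n h hY, ⟨r.map (shiftFunctor C n)⟩⟩

lemma weightPart_unshift {𝒮 : Set C} {p q : ℤ → Prop} (n : ℤ)
    (h : ∀ m, p m → q (m - n)) {X : C} (hX : weightPart 𝒮 p (X⟦n⟧)) : weightPart 𝒮 q X :=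
  (weightPart 𝒮 q).prop_of_iso ((shiftShiftNeg X n)) (weightPart_shift (-n) h hX)

lemma weightPart_mono {𝒮 : Set C} {p q : ℤ → Prop} (h : ∀ m, p m → q m) :
    weightPart 𝒮 p ≤ weightPart 𝒮 q :=
  monotone_retractClosure (extClosure_mono (shiftsOf_mono h))

lemma weightPart_self {𝒮 : Set C} {p : ℤ → Prop} {S : C} (hS : S ∈ 𝒮) (hp : p 0) :
    weightPart 𝒮 p S :=
  le_retractClosure _ _ (extClosure_shiftsOf_self hS hp)

lemma weightPart_le {𝒮 : Set C} {p : ℤ → Prop} {R : ObjectProperty C}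
    [R.IsStableUnderRetracts] [R.ContainsZero] [R.IsTriangulatedClosed₂]
    (h : shiftsOf 𝒮 p ≤ R) : weightPart 𝒮 p ≤ R :=
  (retractClosure_le_iff _ _).2 (extClosure_le h)

lemma hom_weightPart {𝒮 : Set C} {p q : ℤ → Prop}
    (h : ∀ S ∈ 𝒮, ∀ T ∈ 𝒮, ∀ m : ℤ, 0 < m → ∀ f : S ⟶ T⟦m⟧, f = 0)
    (hpq : ∀ a b, p a → q b → a < b) {X Y : C} (hX : weightPart 𝒮 p X)
    (hY : weightPart 𝒮 q Y) (f : X ⟶ Y) : f = 0 := by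
  obtain ⟨X', hX', ⟨r⟩⟩ := hX
  obtain ⟨Y', hY', ⟨s⟩⟩ := hY
  have := hom_extClosure_shiftsOf (fun S hS T hT a b ha hb f =>
    h S hS T hT (b - a) (sub_pos.2 (hpq a b ha hb)) f) hX' hY' (r.r ≫ f ≫ s.i)
  have h' : r.i ≫ (r.r ≫ f ≫ s.i) ≫ s.r = f := by simp
  rw [← h', this]
  simp

/-- An object of `thick 𝒮` involves only finitely many shifts. This bound makes the induction for
direct summands terminate. -/
lemma exists_nat_weightPart_shift {𝒮 : Set C} {X : C} (hX : thick 𝒮 X) :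
    ∃ n : ℕ, weightPart 𝒮 (0 ≤ ·) (X⟦(n : ℤ)⟧) := by
  suffices ∃ n : ℕ, weightPart 𝒮 (-(n : ℤ) ≤ ·) X by
    obtain ⟨n, hn⟩ := this
    exact ⟨n, weightPart_shift _ (fun m hm => by lia) hn⟩
  induction hX with
  | of X hX => exact ⟨0, weightPart_self hX (by simp)⟩
  | zero X hX => exact ⟨0, prop_of_isZero _ hX⟩
  | shift X a _ h =>
    obtain ⟨n, hn⟩ := h
    exact ⟨n + a.natAbs, weightPart_shift a (fun m hm => by lia) hn⟩
  | ext T hT _ _ h₁ h₃ =>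
    obtain ⟨n₁, hn₁⟩ := h₁
    obtain ⟨n₃, hn₃⟩ := h₃
    exact ⟨n₁ + n₃, ext_of_isTriangulatedClosed₂ _ T hT
      (weightPart_mono (fun m hm => by lia) _ hn₁) (weightPart_mono (fun m hm => by lia) _ hn₃)⟩
  | retract X Y r _ h =>
    obtain ⟨n, hn⟩ := h
    exact ⟨n, prop_of_retract _ r hn⟩

/-- If `X` is a direct summand of `Y`, then `X` is an extension of `X'⟦1⟧` by `Y`,
where `X'` is the complement. -/
lemma exists_triangle_of_retract {X Y : C} (r : Retract X Y) :
    ∃ (Z : C) (g : X ⟶ Z) (h : Z ⟶ Y⟦(1 : ℤ)⟧),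
      Triangle.mk r.r g h ∈ distTriang C ∧ Nonempty (Retract Z (Y⟦(1 : ℤ)⟧)) := by
  obtain ⟨Z, g, h, hT⟩ := distinguished_cocone_triangle r.r
  refine ⟨Z, g, h, hT, ?_⟩
  have : Epi r.r := inferInstance
  have hg : g = 0 := (Triangle.mk r.r g h).mor₂_eq_zero_of_epi₁ hT this
  have : Mono h := (Triangle.mk r.r g h).mono₃ hT hg
  have := isSplitMono_of_mono h
  exact ⟨⟨h, retraction h, by simp⟩⟩

variable [IsTriangulated C]

section

variable {𝒮 : Set C} (hneg : ∀ S ∈ 𝒮, ∀ T ∈ 𝒮, ∀ m : ℤ, 0 < m → ∀ f : S ⟶ T⟦m⟧, f = 0)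

include hneg

lemma isTriangulatedClosed₂_extensionProduct_weightPart :
    (extensionProduct (weightPart 𝒮 (· ≤ -1)) (weightPart 𝒮 (0 ≤ ·))).IsTriangulatedClosed₂ := by
  refine extensionProduct_isTriangulatedClosed₂ ?_
  rintro X ⟨Y, Z, f, g, k, hT, hY, hZ⟩
  exact extensionProduct_swap_of_mor₃_eq_zero _ hT hY hZ
    (hom_weightPart (q := (1 ≤ ·)) hneg (fun a b ha hb => by lia) hZ
      (weightPart_shift 1 (fun m hm => by lia) hY) k)

/-- The triangle of `exists_triangle_of_retract` reduces the summand `X` of `Y` to a summand `Z` of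
`Y⟦1⟧`. After `n` steps the ambient object is `Y⟦n⟧`, which lies in a class already closed under
summands. All shifts of `Y` are assumed decomposable because `Y` changes at each step. -/
lemma extensionProduct_weightPart_of_retract (n : ℕ) (X Y : C) (r : Retract X Y)
    (hY : ∀ k : ℤ, extensionProduct (weightPart 𝒮 (· ≤ -1)) (weightPart 𝒮 (0 ≤ ·)) (Y⟦k⟧))
    (hn : weightPart 𝒮 (0 ≤ ·) (Y⟦(n : ℤ)⟧)) :
    extensionProduct (weightPart 𝒮 (· ≤ -1)) (weightPart 𝒮 (0 ≤ ·)) X := by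
  have := isTriangulatedClosed₂_extensionProduct_weightPart hneg
  induction n generalizing X Y with
  | zero =>
    exact le_extensionProduct_right _ _ (prop_of_retract _ r
      (prop_of_iso _ ((shiftFunctorZero C ℤ).app Y) hn))
  | succ n ih =>
    obtain ⟨Z, g, h, hT, ⟨s⟩⟩ := exists_triangle_of_retract r
    refine ext_of_isTriangulatedClosed₂ _ _ hT
      (prop_of_iso _ ((shiftFunctorZero C ℤ).app Y) (hY 0)) (ih Z _ s (fun k => ?_) ?_)
    · exact prop_of_iso _ ((shiftFunctorAdd C 1 k).app Y) (hY (1 + k))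
    · exact prop_of_iso _ ((shiftFunctorAdd' C 1 (n : ℤ) _ (by push_cast; ring)).app Y) hn

lemma extensionProduct_weightPart_of_thick {X : C} (hX : thick 𝒮 X) (k : ℤ) :
    extensionProduct (weightPart 𝒮 (· ≤ -1)) (weightPart 𝒮 (0 ≤ ·)) (X⟦k⟧) := by
  have := isTriangulatedClosed₂_extensionProduct_weightPart hneg
  induction hX generalizing k with
  | of X hX =>
    by_cases hk : 0 ≤ k
    · exact le_extensionProduct_right _ _
        (le_retractClosure _ _ (extClosure_shiftsOf_of_mem hX hk))
    · exact le_extensionProduct_left _ _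
        (le_retractClosure _ _ (extClosure_shiftsOf_of_mem hX (by lia)))
  | zero X hX =>
    exact le_extensionProduct_left _ _
      (prop_of_isZero _ ((shiftFunctor C k).map_isZero hX))
  | shift X a _ h => exact prop_of_iso _ ((shiftFunctorAdd C a k).app X) (h (a + k))
  | ext T hT _ _ h₁ h₃ =>
    exact ext_of_isTriangulatedClosed₂ _ _ (T.shift_distinguished hT k) (h₁ k) (h₃ k)
  | retract X Y r hY h =>
    obtain ⟨n, hn⟩ := exists_nat_weightPart_shift (hY.shift _ k)
    exact extensionProduct_weightPart_of_retract hneg n _ _ (r.map (shiftFunctor C k))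
      (fun a => prop_of_iso _ ((shiftFunctorAdd C k a).app Y) (h (k + a))) hn

/-- The weight structure on `C = thick 𝒮` defined by a negative collection `𝒮`. -/
def weightStructureOf (hgen : ∀ X : C, thick 𝒮 X) : WeightStructure C where
  le := weightPart 𝒮 (0 ≤ ·)
  ge := weightPart 𝒮 (· ≤ 0)
  le_retracts := inferInstance
  ge_retracts := inferInstance
  le_shift X hX := weightPart_shift 1 (fun m hm => by lia) hX
  ge_shift X hX := weightPart_shift (-1) (fun m hm => by lia) hX
  hom_eq_zero X Y f hX hY :=
    -- `X⟦1⟧` is built from shifts `≤ 0`, so `X` is built from shifts `≤ -1`.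
    hom_weightPart (p := (· ≤ -1)) hneg (fun a b ha hb => by lia)
      (weightPart_unshift 1 (fun m hm => by lia) hX) hY f
  exists_triangle X := by
    obtain ⟨A, B, f, g, h, hT, hA, hB⟩ := prop_of_iso _ ((shiftFunctorZero C ℤ).app X)
      (extensionProduct_weightPart_of_thick hneg (hgen X) 0)
    exact ⟨A, B, f, g, h, hT, weightPart_shift 1 (fun m hm => by lia) hA, hB⟩

end

end Weight

/-! ### Passing between `thick 𝓟` and the ambient category -/

section FullSubcategory

variable {D : Type u} [Category.{v} D] [Preadditive D] [HasZeroObject D] [HasShift D ℤ]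
  [∀ n : ℤ, (shiftFunctor D n).Additive] [Pretriangulated D]

/-- Each step of a construction in `D` stays inside `thick 𝓟`, so its triangles and retractions lift
along the fully faithful inclusion. -/
lemma thick_fullSubcategory (𝓟 : Set D) (X : (thick 𝓟).FullSubcategory) :
    thick {X : (thick 𝓟).FullSubcategory | X.obj ∈ 𝓟} X := by
  obtain ⟨X, hX⟩ := X
  induction hX with
  | of X hX => exact .of _ hX
  | zero X hX =>
    exact .zero _ (by
      rw [IsZero.iff_id_eq_zero]
      ext
      exact hX.eq_of_src _ _)
  | shift X n hX h =>
    exact prop_of_iso _ ((thick 𝓟).fullyFaithfulι.preimageIso (Y := ⟨X⟦n⟧, hX.shift _ n⟩)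
      (((thick 𝓟).ι.commShiftIso n).app ⟨X, hX⟩)) (.shift _ n h)
  | ext T hT h₁' h₃' h₁ h₃ =>
    let X₁ : (thick 𝓟).FullSubcategory := ⟨T.obj₁, h₁'⟩
    let X₂ : (thick 𝓟).FullSubcategory := ⟨T.obj₂, .ext T hT h₁' h₃'⟩
    let X₃ : (thick 𝓟).FullSubcategory := ⟨T.obj₃, h₃'⟩
    refine thick.ext (Triangle.mk
      ((thick 𝓟).fullyFaithfulι.preimage (X := X₁) (Y := X₂) T.mor₁)
      ((thick 𝓟).fullyFaithfulι.preimage (X := X₂) (Y := X₃) T.mor₂)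
      ((thick 𝓟).fullyFaithfulι.preimage (X := X₃) (Y := X₁⟦(1 : ℤ)⟧)
        (T.mor₃ ≫ ((thick 𝓟).ι.commShiftIso (1 : ℤ)).inv.app X₁))) ?_ h₁ h₃
    exact isomorphic_distinguished _ hT _
      (Triangle.isoMk _ _ (Iso.refl _) (Iso.refl _) (Iso.refl _)
        ((Category.comp_id _).trans (Category.id_comp _).symm)
        ((Category.comp_id _).trans (Category.id_comp _).symm) (by
          change ((T.mor₃ ≫ ((thick 𝓟).ι.commShiftIso (1 : ℤ)).inv.app X₁) ≫
            ((thick 𝓟).ι.commShiftIso (1 : ℤ)).hom.app X₁) ≫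
              (shiftFunctor D (1 : ℤ)).map (𝟙 T.obj₁) = 𝟙 _ ≫ T.mor₃
          refine (congrArg (_ ≫ ·) ((shiftFunctor D (1 : ℤ)).map_id T.obj₁)).trans ?_
          refine (Category.comp_id _).trans ((Category.assoc _ _ _).trans ?_)
          refine (congrArg (T.mor₃ ≫ ·)
            (((thick 𝓟).ι.commShiftIso (1 : ℤ)).inv_hom_id_app X₁)).trans ?_
          exact (Category.comp_id _).trans (Category.id_comp _).symm))
  | retract X Y r hY h =>
    exact .retract _ _
      ⟨(thick 𝓟).fullyFaithfulι.preimage (X := ⟨X, .retract X Y r hY⟩) (Y := ⟨Y, hY⟩) r.i,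
        (thick 𝓟).fullyFaithfulι.preimage (X := ⟨Y, hY⟩) (Y := ⟨X, .retract X Y r hY⟩) r.r,
        by ext; exact r.retract⟩ h

lemma hom_fullSubcategory_shift_eq_zero {𝓟 : Set D}
    (h : ∀ P ∈ 𝓟, ∀ Q ∈ 𝓟, ∀ m : ℤ, 0 < m → ∀ f : P ⟶ Q⟦m⟧, f = 0)
    (X : (thick 𝓟).FullSubcategory) (hX : X.obj ∈ 𝓟)
    (Y : (thick 𝓟).FullSubcategory) (hY : Y.obj ∈ 𝓟) (m : ℤ) (hm : 0 < m)
    (f : X ⟶ Y⟦m⟧) : f = 0 := by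
  have := h _ hX _ hY m hm ((thick 𝓟).ι.map f ≫ ((thick 𝓟).ι.commShiftIso m).hom.app Y)
  apply (thick 𝓟).ι.map_injective
  rw [Functor.map_zero, ← cancel_mono (((thick 𝓟).ι.commShiftIso m).hom.app Y), zero_comp]
  exact this

lemma weightPart_obj {𝓟 : Set D} {p : ℤ → Prop} {X : (thick 𝓟).FullSubcategory}
    (hX : weightPart {X : (thick 𝓟).FullSubcategory | X.obj ∈ 𝓟} p X) :
    weightPart 𝓟 p X.obj := by
  obtain ⟨Y, hY, ⟨r⟩⟩ := hX
  refine ⟨Y.obj, ?_, ⟨r.map (thick 𝓟).ι⟩⟩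
  clear r
  induction hY with
  | of Y hY =>
    obtain ⟨S, hS, m, hm, ⟨e⟩⟩ := hY
    exact .of _ ⟨S.obj, hS, m, hm,
      ⟨(thick 𝓟).ι.mapIso e ≪≫ ((thick 𝓟).ι.commShiftIso m).app S⟩⟩
  | zero Y hY => exact .zero _ ((thick 𝓟).ι.map_isZero hY)
  | ext T hT _ _ h₁ h₃ =>
    exact .ext _ ((thick 𝓟).ι.map_distinguished T hT) h₁ h₃

end FullSubcategory

section SimpleMinded

variable {D : Type u} [Category.{v} D] [Preadditive D] [HasZeroObject D] [HasShift D ℤ]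
  [∀ n : ℤ, (shiftFunctor D n).Additive] [Pretriangulated D]

/-! ### The t-structure of a simple-minded collection -/

lemma extClosure_shiftsOf_of_tria {𝓛 : Set D} {X : D} (hX : tria 𝓛 X) :
    extClosure (shiftsOf 𝓛 (fun _ => True)) X := by
  induction hX with
  | of X hX => exact extClosure_shiftsOf_self hX trivial
  | zero X hX => exact .zero _ hX
  | shift X n _ h => exact extClosure_shiftsOf_shift n (fun _ _ => trivial) h
  | ext T hT _ _ h₁ h₃ => exact .ext T hT h₁ h₃

variable {𝓛 : Set D} (h𝓛 : IsSimpleMindedCollection 𝓛)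

include h𝓛

lemma IsSimpleMindedCollection.isIso_of_ne_zero {L L' : D} (hL : L ∈ 𝓛) (hL' : L' ∈ 𝓛)
    {f : L ⟶ L'} (hf : f ≠ 0) : IsIso f := by
  by_cases h : L = L'
  · subst h
    exact (isUnit_iff_isIso (f : End L)).1 ((h𝓛.division L hL).2 f hf)
  · exact (hf (h𝓛.hom_ne L hL L' hL' h f)).elim

lemma IsSimpleMindedCollection.eq_zero_or_isIso {L L' : D} (hL : L ∈ 𝓛) (hL' : L' ∈ 𝓛)
    {a b : ℤ} (hab : b ≤ a) {X Y : D} (e : X ≅ L⟦a⟧) (e' : Y ≅ L'⟦b⟧) (f : X ⟶ Y) :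
    f = 0 ∨ IsIso f := by
  obtain hab | rfl := hab.lt_or_eq
  · exact .inl (hom_eq_zero_of_iso e e' (hom_shift_eq_zero (sub_add_cancel b a)
      (h𝓛.hom_neg L hL L' hL' (b - a) (by lia))) f)
  · obtain ⟨g, hg⟩ := (shiftFunctor D b).map_surjective (e.inv ≫ f ≫ e'.hom)
    have hf : f = e.hom ≫ g⟦b⟧' ≫ e'.inv := by simp [hg]
    by_cases h : g = 0
    · left
      simp [hf, h]
    · right
      have := h𝓛.isIso_of_ne_zero hL hL' h
      rw [hf]
      infer_instance

lemma IsSimpleMindedCollection.hom_extClosure_eq_zero {p q : ℤ → Prop}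
    (hpq : ∀ a b, p a → q b → b < a) {X Y : D} (hX : extClosure (shiftsOf 𝓛 p) X)
    (hY : extClosure (shiftsOf 𝓛 q) Y) (f : X ⟶ Y) : f = 0 :=
  hom_extClosure_shiftsOf (fun L hL L' hL' a b ha hb =>
    h𝓛.hom_neg L hL L' hL' (b - a) (sub_neg.2 (hpq a b ha hb))) hX hY f

variable [IsTriangulated D]

lemma IsSimpleMindedCollection.extensionProduct_le :
    extensionProduct (extClosure (shiftsOf 𝓛 (· ≤ -1))) (extClosure (shiftsOf 𝓛 (0 ≤ ·))) ≤
      extensionProduct (extClosure (shiftsOf 𝓛 (0 ≤ ·))) (extClosure (shiftsOf 𝓛 (· ≤ -1))) := by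
  -- Zero objects are adjoined because the extension `X` may vanish and must still be of the form
  -- `extClosure * R`.
  let R : ObjectProperty D := fun X => shiftsOf 𝓛 (· ≤ -1) X ∨ IsZero X
  have : R.ContainsZero := ⟨0, isZero_zero D, .inr (isZero_zero D)⟩
  have : R.IsClosedUnderIsomorphisms := ⟨by
    rintro X Y e (⟨L, hL, m, hm, ⟨e'⟩⟩ | h)
    · exact .inl ⟨L, hL, m, hm, ⟨e.symm ≪≫ e'⟩⟩
    · exact .inr (h.of_iso e.symm)⟩
  have hR : extensionProduct R (extClosure (shiftsOf 𝓛 (0 ≤ ·))) ≤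
      extensionProduct (extClosure (shiftsOf 𝓛 (0 ≤ ·))) R := by
    refine extensionProduct_extClosure_le_of_right ?_
    rintro X ⟨Y, Z, f, g, k, hT, (⟨L, hL, a, ha, ⟨e⟩⟩ | hY), ⟨L', hL', b, hb, ⟨e'⟩⟩⟩
    -- The connecting morphism is `L'⟦b⟧ ⟶ L⟦a + 1⟧` with `a + 1 ≤ 0 ≤ b`. If zero, the extension
    -- splits; if invertible, the middle term is zero.
    · obtain hk | hk := h𝓛.eq_zero_or_isIso hL' hL (a := b) (b := a + 1) (by lia) e'
        ((shiftFunctor D (1 : ℤ)).mapIso e ≪≫ (shiftFunctorAdd D a 1).symm.app L) k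
      · exact extensionProduct_swap_of_mor₃_eq_zero _ hT (.inl ⟨L, hL, a, ha, ⟨e⟩⟩)
          (.of _ ⟨L', hL', b, hb, ⟨e'⟩⟩) hk
      · exact le_extensionProduct_left _ _
          (.zero _ (((Triangle.mk f g k).isZero₂_iff_isIso₃ hT).2 hk))
    · have : IsIso g := ((Triangle.mk f g k).isZero₁_iff_isIso₂ hT).1 hY
      exact le_extensionProduct_left _ _ (.of _ ⟨L', hL', b, hb, ⟨asIso g ≪≫ e'⟩⟩)
  refine extensionProduct_extClosure_le_of_left ?_
  refine (monotone_extensionProduct_left _ (fun X hX => .inl hX)).trans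
    (hR.trans (monotone_extensionProduct_right _ ?_))
  rintro X (hX | hX)
  · exact .of _ hX
  · exact .zero _ hX

lemma IsSimpleMindedCollection.extensionProduct_top (X : D) :
    extensionProduct (extClosure (shiftsOf 𝓛 (0 ≤ ·))) (extClosure (shiftsOf 𝓛 (· ≤ -1))) X := by
  have := extensionProduct_isTriangulatedClosed₂ h𝓛.extensionProduct_le
  have : (extensionProduct (extClosure (shiftsOf 𝓛 (0 ≤ ·)))
      (extClosure (shiftsOf 𝓛 (· ≤ -1)))).ContainsZero :=
    ⟨0, isZero_zero D, le_extensionProduct_left _ _ (.zero _ (isZero_zero D))⟩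
  refine extClosure_le ?_ X (extClosure_shiftsOf_of_tria (h𝓛.generates X))
  rintro Y ⟨L, hL, m, -, e⟩
  by_cases hm : 0 ≤ m
  · exact le_extensionProduct_left _ _ (.of _ ⟨L, hL, m, hm, e⟩)
  · exact le_extensionProduct_right _ _ (.of _ ⟨L, hL, m, by lia, e⟩)

/-- The t-structure defined by a simple-minded collection. -/
def IsSimpleMindedCollection.tStructure : TStructure D where
  le n := extClosure (shiftsOf 𝓛 (-n ≤ ·))
  ge n := extClosure (shiftsOf 𝓛 (· ≤ -n))
  le_shift n a n' h X hX := extClosure_shiftsOf_shift a (fun m hm => by lia) hX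
  ge_shift n a n' h X hX := extClosure_shiftsOf_shift a (fun m hm => by lia) hX
  zero' X Y f hX hY := h𝓛.hom_extClosure_eq_zero (fun a b ha hb => by lia) hX hY f
  le_zero_le := extClosure_mono (shiftsOf_mono fun m hm => by lia)
  ge_one_le := extClosure_mono (shiftsOf_mono fun m hm => by lia)
  exists_triangle_zero_one X := by
    obtain ⟨A, B, f, g, h, hT, hA, hB⟩ := h𝓛.extensionProduct_top X
    exact ⟨A, B, by simpa using hA, hB, f, g, h, hT⟩

lemma IsSimpleMindedCollection.isTStructureOf : IsTStructureOf 𝓛 h𝓛.tStructure := by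
  constructor
  · change extClosure (shiftsOf 𝓛 (-0 ≤ ·)) = _
    rw [neg_zero]
  · change extClosure (shiftsOf 𝓛 (· ≤ -0)) = _
    rw [neg_zero]

end SimpleMinded

/-! ### Derived projectivity, orthogonality and the silting t-structure -/

section Orthogonality

variable {D : Type u} [Category.{v} D] [Preadditive D] [HasZeroObject D] [HasShift D ℤ]
  [∀ n : ℤ, (shiftFunctor D n).Additive] [Pretriangulated D]

lemma exists_retract_of_mor₂_eq_zero (T : Triangle D) (hT : T ∈ distTriang D)
    (h : T.mor₂ = 0) : Nonempty (Retract T.obj₂ T.obj₁) := by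
  have := T.epi₁ hT h
  have := isSplitEpi_of_epi T.mor₁
  exact ⟨⟨section_ T.mor₁, T.mor₁, by simp⟩⟩

lemma exists_retract_of_mor₁_eq_zero (T : Triangle D) (hT : T ∈ distTriang D)
    (h : T.mor₁ = 0) : Nonempty (Retract T.obj₂ T.obj₃) := by
  have := T.mono₂ hT h
  have := isSplitMono_of_mono T.mor₂
  exact ⟨⟨T.mor₂, retraction T.mor₂, by simp⟩⟩

/-! ### Derived projective objects -/

section

variable {t : TStructure D} {P : D}

lemma IsDerivedProjective.hom_le_eq_zero (hP : IsDerivedProjective t P) {Y : D} {n : ℤ}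
    (hn : n ≤ -1) (hY : t.le n Y) (f : P ⟶ Y) : f = 0 :=
  hom_eq_zero_of_iso (Iso.refl P) (shiftNegShift Y (1 : ℤ)).symm
    (hP.hom_eq_zero _ (t.le_shift (-1) (-1) 0 (by lia) _ (t.le_monotone hn _ hY))) f

lemma IsDerivedProjective.hom_ge_eq_zero (hP : IsDerivedProjective t P) {Y : D} {n : ℤ}
    (hn : 1 ≤ n) (hY : t.ge n Y) (f : P ⟶ Y) : f = 0 :=
  t.zero' f hP.le_zero (t.ge_antitone hn _ hY)

end

/-- Each half of a t-structure is the orthogonal of the other, so enlarging one half shrinks the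
other. -/
lemma tStructure_eq_of_le {t t' : TStructure D} (h : t.le 0 ≤ t'.le 0) (h' : t.ge 0 ≤ t'.ge 0)
    [IsTriangulated D] : t.le 0 = t'.le 0 ∧ t.ge 0 = t'.ge 0 := by
  refine ⟨le_antisymm h fun X hX => ?_, le_antisymm h' fun X hX => ?_⟩
  · refine (t.le_iff_isLE X 0).2 ((t.isLE_iff_orthogonal 0 1 rfl X).2 fun Y f hY => ?_)
    refine t'.zero' f hX ?_
    rw [← t'.shift_ge 1 0 1 rfl]
    exact h' _ (t.ge_shift 1 1 0 (by lia) _ hY.ge)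
  · refine (t.ge_iff_isGE X 0).2 ((t.isGE_iff_orthogonal (-1) 0 rfl X).2 fun Y f hY => ?_)
    have hY' : t'.le (-1) Y := by
      rw [← t'.shift_le (-1) 0 (-1) rfl]
      exact h _ (t.le_shift (-1) (-1) 0 (by lia) _ hY.le)
    exact t'.zero_of_isLE_of_isGE f (-1) 0 (by lia) ⟨hY'⟩ ⟨hX⟩

variable [IsTriangulated D] {𝓟 : Set D}

lemma IsSiltingTStructure.isDerivedProjective {t : TStructure D} (ht : IsSiltingTStructure 𝓟 t)
    {P : D} (hP : P ∈ 𝓟) : IsDerivedProjective t P where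
  le_zero := by
    refine (t.le_iff_isLE P 0).2 ((t.isLE_iff_orthogonal 0 1 rfl P).2 fun Y f hY => ?_)
    have hY' : t.ge 0 (Y⟦(1 : ℤ)⟧) := t.ge_shift 1 1 0 (by lia) _ hY.ge
    rw [ht.2] at hY'
    exact hom_eq_zero_of_iso (Iso.refl P) (shiftShiftNeg Y (1 : ℤ)).symm
      (hY' P hP (-1) (by lia)) f
  hom_eq_zero X hX f := by
    rw [ht.1] at hX
    exact hX P hP 1 (by lia) f

lemma isSiltingTStructure_of_isDerivedProjective {t t' : TStructure D}
    (ht' : IsSiltingTStructure 𝓟 t') (h : ∀ P ∈ 𝓟, IsDerivedProjective t P) :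
    IsSiltingTStructure 𝓟 t := by
  have := tStructure_eq_of_le (t := t) (t' := t')
    (by
      rw [ht'.1]
      intro Y hY P hP m hm f
      exact (h P hP).hom_le_eq_zero (n := -m) (by lia) (t.le_shift 0 m _ (by lia) _ hY) f)
    (by
      rw [ht'.2]
      intro Y hY P hP m hm f
      exact (h P hP).hom_ge_eq_zero (n := -m) (by lia) (t.ge_shift 0 m _ (by lia) _ hY) f)
  exact ⟨this.1.trans ht'.1, this.2.trans ht'.2⟩

lemma IsSiltingCollection.hom_shift_eq_zero (h𝓟 : IsSiltingCollection 𝓟) {P Q : D}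
    (hP : P ∈ 𝓟) (hQ : Q ∈ 𝓟) (m : ℤ) (hm : 0 < m) (f : P ⟶ Q⟦m⟧) : f = 0 := by
  obtain ⟨t, ht⟩ := h𝓟.exists_tStructure
  have hQ' := (ht.isDerivedProjective hQ).le_zero
  rw [ht.1] at hQ'
  exact hQ' P hP m hm f

section

variable {t : TStructure D} (h : ∀ P ∈ 𝓟, IsDerivedProjective t P)

include h

lemma weightPart_le_leftOrthogonal_le {n k : ℤ} (hnk : n + k = -1) :
    weightPart 𝓟 (· ≤ n) ≤ (t.le k).leftOrthogonal := by
  refine weightPart_le ?_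
  rintro X ⟨P, hP, m, hm, ⟨e⟩⟩ Y f hY
  exact hom_eq_zero_of_iso e ((shiftFunctorZero D ℤ).app Y).symm
    (hom_shift_eq_zero (neg_add_cancel m)
      ((h P hP).hom_le_eq_zero (n := k + m) (by lia) (t.le_shift k (-m) _ (by lia) _ hY))) f

lemma weightPart_le_leftOrthogonal_ge {n k : ℤ} (hnk : n + k = 1) :
    weightPart 𝓟 (n ≤ ·) ≤ (t.ge k).leftOrthogonal := by
  refine weightPart_le ?_
  rintro X ⟨P, hP, m, hm, ⟨e⟩⟩ Y f hY
  exact hom_eq_zero_of_iso e ((shiftFunctorZero D ℤ).app Y).symm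
    (hom_shift_eq_zero (neg_add_cancel m)
      ((h P hP).hom_ge_eq_zero (n := k + m) (by lia) (t.ge_shift k (-m) _ (by lia) _ hY))) f

lemma weightPart_le_le {n k : ℤ} (hnk : n + k = 0) : weightPart 𝓟 (n ≤ ·) ≤ t.le k := by
  intro X hX
  refine (t.le_iff_isLE X k).2 ((t.isLE_iff_orthogonal k (k + 1) rfl X).2 fun Y f hY => ?_)
  exact weightPart_le_leftOrthogonal_ge h (by lia) X hX f hY.ge

end

/-! ### Orthogonality of the weight structure of `𝓟` and a t-structure -/

lemma hom_obj_shift_eq_zero {X : (thick 𝓟).FullSubcategory} {m : ℤ} {Y : D}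
    (H : ∀ f : (X⟦m⟧).obj ⟶ Y, f = 0) (f : X.obj ⟶ Y⟦-m⟧) : f = 0 :=
  eq_zero_of_hom_shift_eq_zero (neg_add_cancel m) (fun g =>
    hom_eq_zero_of_iso (((thick 𝓟).ι.commShiftIso m).app X).symm
      ((shiftFunctorZero D ℤ).app Y) H g) f

variable {w : WeightStructure (thick 𝓟).FullSubcategory}

lemma IsWeightStructureOf.le_eq (hw : IsWeightStructureOf 𝓟 w) :
    w.le = weightPart {X : (thick 𝓟).FullSubcategory | X.obj ∈ 𝓟} (0 ≤ ·) :=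
  hw.1.trans (Kar_eq_retractClosure _)

lemma IsWeightStructureOf.ge_eq (hw : IsWeightStructureOf 𝓟 w) :
    w.ge = weightPart {X : (thick 𝓟).FullSubcategory | X.obj ∈ 𝓟} (· ≤ 0) :=
  hw.2.trans (Kar_eq_retractClosure _)

lemma IsSiltingCollection.exists_weightStructure (h𝓟 : IsSiltingCollection 𝓟) :
    ∃ w : WeightStructure (thick 𝓟).FullSubcategory, IsWeightStructureOf 𝓟 w :=
  ⟨weightStructureOf (hom_fullSubcategory_shift_eq_zero fun _ hP _ hQ m hm f =>
      h𝓟.hom_shift_eq_zero hP hQ m hm f) (thick_fullSubcategory 𝓟),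
    (Kar_eq_retractClosure _).symm, (Kar_eq_retractClosure _).symm⟩

section

variable {t : TStructure D} (hw : IsWeightStructureOf 𝓟 w)

include hw

lemma isLeftOrthogonal_of_isDerivedProjective (h : ∀ P ∈ 𝓟, IsDerivedProjective t P) :
    IsLeftOrthogonal w t where
  ge_perp X Y hX hY f :=
    weightPart_le_leftOrthogonal_le h (by lia) _ (weightPart_obj (hw.ge_eq ▸ hX)) f hY
  le_perp X Y hX hY f :=
    weightPart_le_leftOrthogonal_ge h (by lia) _ (weightPart_obj (hw.le_eq ▸ hX)) f hY

lemma isDerivedProjective_of_isLeftOrthogonal (h : IsLeftOrthogonal w t) {P : D}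
    (hP : P ∈ 𝓟) : IsDerivedProjective t P where
  le_zero := by
    refine (t.le_iff_isLE P 0).2 ((t.isLE_iff_orthogonal 0 1 rfl P).2 fun Y f hY => ?_)
    refine h.le_perp ⟨P, .of P hP⟩ Y ?_ hY.ge f
    rw [hw.le_eq]
    exact weightPart_self hP le_rfl
  hom_eq_zero X hX f := by
    refine h.ge_perp ⟨P, .of P hP⟩ _ ?_ (t.le_shift 0 1 (-1) (by lia) _ hX) f
    rw [hw.ge_eq]
    exact weightPart_self hP le_rfl

/-- The defining conditions of the silting t-structure test only against shifts of `𝓟`: the shifts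
`P⟦1 - m⟧` with `m > 0` lie in `w.ge`, the shifts `P⟦-1 - m⟧` with `m < 0` in `w.le`. -/
lemma isTStrict_of_isSiltingTStructure (h : IsSiltingTStructure 𝓟 t) : IsTStrict w t := by
  have ho := isLeftOrthogonal_of_isDerivedProjective hw fun _ hP => h.isDerivedProjective hP
  constructor
  · refine fun Y => ⟨fun hY X hX f => ho.ge_perp X Y hX hY f, fun H => ?_⟩
    rw [← t.shift_le (-1) 0 (-1) rfl, prop_shift_iff, h.1]
    intro P hP m hm
    refine hom_eq_zero_of_iso (Iso.refl P)
      ((shiftFunctorAdd' D (-1) m (-(1 - m)) (by lia)).app Y).symm ?_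
    refine hom_obj_shift_eq_zero (X := ⟨P, .of P hP⟩) (H _ ?_)
    rw [hw.ge_eq]
    exact weightPart_shift (p := (· = 0)) _ (fun a ha => by lia) (weightPart_self hP rfl)
  · refine fun Y => ⟨fun hY X hX f => ho.le_perp X Y hX hY f, fun H => ?_⟩
    rw [← t.shift_ge 1 0 1 rfl, prop_shift_iff, h.2]
    intro P hP m hm
    refine hom_eq_zero_of_iso (Iso.refl P)
      ((shiftFunctorAdd' D 1 m (-(-1 - m)) (by lia)).app Y).symm ?_
    refine hom_obj_shift_eq_zero (X := ⟨P, .of P hP⟩) (H _ ?_)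
    rw [hw.le_eq]
    exact weightPart_shift (p := (· = 0)) _ (fun a ha => by lia) (weightPart_self hP rfl)

/-- If `X` satisfies the orthogonality condition, one of the maps of a weight decomposition of `X`
vanishes, so `X` is a summand of the other piece. -/
lemma isWStrict_of_isDerivedProjective (h : ∀ P ∈ 𝓟, IsDerivedProjective t P) :
    IsWStrict w t := by
  have ho := isLeftOrthogonal_of_isDerivedProjective hw h
  have := w.le_retracts
  have := w.ge_retracts
  constructor
  · refine fun X => ⟨fun hX Y hY f => ho.ge_perp X Y hX hY f, fun H => ?_⟩
    -- Decomposing `X⟦-1⟧` and shifting back moves the cut by one: the pieces of `X` are `A⟦1⟧` in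
    -- `w.ge` and `B⟦1⟧`, which lies in `t.le (-1)`.
    obtain ⟨A, B, f, g, k, hT, hA, hB⟩ := w.exists_triangle (X⟦(-1 : ℤ)⟧)
    have hT' := Triangle.shift_distinguished _ hT 1
    obtain ⟨r⟩ := exists_retract_of_mor₂_eq_zero _ hT' (by
      refine hom_eq_zero_of_iso (shiftNegShift X (1 : ℤ)) (Iso.refl _) (fun l => ?_) _
      apply (thick 𝓟).ι.map_injective
      rw [Functor.map_zero]
      refine H _ ?_ _
      refine weightPart_le_le h (n := 1) (by lia) _ (weightPart_obj ?_)
      exact weightPart_shift 1 (fun m hm => by lia) (hw.le_eq ▸ hB))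
    exact prop_of_iso _ (shiftNegShift X (1 : ℤ)) (prop_of_retract _ r hA)
  · refine fun X => ⟨fun hX Y hY f => ho.le_perp X Y hX hY f, fun H => ?_⟩
    obtain ⟨A, B, f, g, k, hT, hA, hB⟩ := w.exists_triangle X
    obtain ⟨r⟩ := exists_retract_of_mor₁_eq_zero _ hT (by
      apply (thick 𝓟).ι.map_injective
      rw [Functor.map_zero]
      -- `A` has no morphisms to `D^{t ≤ 0}`, and the hypothesis on `X` says precisely that `X` lies
      -- there.
      refine weightPart_le_leftOrthogonal_le h (n := -1) (k := 0) (by lia) _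
        (weightPart_obj (weightPart_unshift 1 (fun m hm => by lia) (hw.ge_eq ▸ hA))) _ ?_
      exact (t.le_iff_isLE _ 0).2 ((t.isLE_iff_orthogonal 0 1 rfl _).2 fun Y l hY =>
        H Y hY.ge l))
    exact prop_of_retract _ r hB

lemma isWTStrictlyLeftOrthogonal_of_isSiltingTStructure (h : IsSiltingTStructure 𝓟 t) :
    IsWTStrictlyLeftOrthogonal w t :=
  ⟨isLeftOrthogonal_of_isDerivedProjective hw fun _ hP => h.isDerivedProjective hP,
    isWStrict_of_isDerivedProjective hw fun _ hP => h.isDerivedProjective hP,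
    isTStrict_of_isSiltingTStructure hw h⟩

end

end Orthogonality

/-! ### Local endomorphism rings of the members of a silting collection -/

section LocalEndomorphismRings

variable {D : Type u} [Category.{v} D] [Preadditive D]

lemma isIso_or_isIso_id_sub {P : D} [IsLocalRing (End P)] (e : P ⟶ P) :
    IsIso e ∨ IsIso (𝟙 P - e) := by
  have := IsLocalRing.isUnit_or_isUnit_of_add_one (R := End P) (a := e)
    (b := (𝟙 P - e : P ⟶ P)) (show (e + (𝟙 P - e) : P ⟶ P) = 𝟙 P by abel)
  rw [isUnit_iff_isIso, isUnit_iff_isIso] at this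
  exact this

/-- Otherwise `𝟙 P - e` is invertible, yet it kills `f`. -/
lemma isIso_of_comp_eq {P X : D} [IsLocalRing (End P)] {e : P ⟶ P} {f : P ⟶ X}
    (hf : f ≠ 0) (h : e ≫ f = f) : IsIso e := by
  refine (isIso_or_isIso_id_sub e).resolve_right fun _ => hf ?_
  rw [← cancel_epi (𝟙 P - e)]
  simp [h]

variable [HasZeroObject D] [HasShift D ℤ]
  [∀ n : ℤ, (shiftFunctor D n).Additive] [Pretriangulated D]

lemma isLocalRing_end_of_iso {X Y : D} (e : X ≅ Y) [IsLocalRing (End X)] :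
    IsLocalRing (End Y) := by
  have : Nontrivial (End Y) := (Iso.conj e).toEquiv.symm.nontrivial
  refine ⟨fun {a b} (hab : (a + b : Y ⟶ Y) = 𝟙 Y) => ?_⟩
  have key : ∀ c : Y ⟶ Y, IsIso (e.hom ≫ c ≫ e.inv) → IsIso c := fun c _ => by
    rw [show c = e.inv ≫ (e.hom ≫ c ≫ e.inv) ≫ e.hom by simp]
    infer_instance
  have h := IsLocalRing.isUnit_or_isUnit_of_add_one (R := End X)
    (a := (e.hom ≫ a ≫ e.inv : X ⟶ X)) (b := (e.hom ≫ b ≫ e.inv : X ⟶ X))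
    (show (e.hom ≫ a ≫ e.inv + e.hom ≫ b ≫ e.inv : X ⟶ X) = 𝟙 X by
      rw [← Preadditive.comp_add, ← Preadditive.add_comp, hab]
      simp)
  rw [isUnit_iff_isIso, isUnit_iff_isIso] at h
  rw [isUnit_iff_isIso, isUnit_iff_isIso]
  exact h.imp (key a) (key b)

lemma isIso_of_indecomposable_of_retract {P Y : D} (hP : Indecomposable P) (hY : ¬ IsZero Y)
    (r : Retract Y P) : IsIso r.i := by
  obtain ⟨Z, g, h, hT⟩ := distinguished_cocone_triangle r.i
  have h0 : h = 0 := (Triangle.mk r.i g h).mor₃_eq_zero_of_mono₁ hT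
    (inferInstanceAs (Mono r.i))
  obtain ⟨e, -⟩ := exists_iso_binaryBiproduct_of_distTriang _ hT h0
  have hZ : IsZero Z := (hP.2 _ _ e).resolve_left hY
  exact ((Triangle.mk r.i g h).isZero₃_iff_isIso₁ hT).1 hZ

/-- A Krull–Schmidt decomposition of `P` has a nonzero summand with local endomorphism ring, and by
indecomposability this summand is all of `P`. -/
lemma IsSiltingCollection.isLocalRing {𝓟 : Set D} (h𝓟 : IsSiltingCollection 𝓟) {P : D}
    (hP : P ∈ 𝓟) : IsLocalRing (End P) := by
  obtain ⟨n, Y, hY, ⟨e⟩⟩ := h𝓟.krullSchmidt P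
    ⟨1, fun _ => P, fun _ => hP,
      ⟨⟨biproduct.ι (fun _ : Fin 1 => P) 0, biproduct.π (fun _ : Fin 1 => P) 0, by simp⟩⟩⟩
  have hn : ∃ i : Fin n, True := by
    by_contra hn
    have : IsEmpty (Fin n) := ⟨fun i => hn ⟨i, trivial⟩⟩
    refine (h𝓟.indecomposable P hP).1 (IsZero.of_iso ?_ e)
    rw [IsZero.iff_id_eq_zero]
    ext i
    exact isEmptyElim i
  obtain ⟨i, -⟩ := hn
  have := (hY i).2
  let r : Retract (Y i) P := ⟨biproduct.ι Y i ≫ e.inv, e.hom ≫ biproduct.π Y i, by simp⟩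
  have hYi : ¬ IsZero (Y i) := fun h =>
    one_ne_zero (α := End (Y i)) (h.eq_of_src (𝟙 (Y i)) 0)
  have := isIso_of_indecomposable_of_retract (h𝓟.indecomposable P hP) hYi r
  exact isLocalRing_end_of_iso (asIso r.i)

end LocalEndomorphismRings

section Simple

variable {D : Type u} [Category.{v} D] [Preadditive D] [HasZeroObject D] [HasShift D ℤ]
  [∀ n : ℤ, (shiftFunctor D n).Additive] [Pretriangulated D] [IsTriangulated D]
  {𝓟 𝓛 : Set D}

/-! ### Morphisms to the simple objects -/

section

variable (h𝓛 : IsSimpleMindedCollection 𝓛)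

lemma IsSimpleMindedCollection.le_zero {L : D} (hL : L ∈ 𝓛) : h𝓛.tStructure.le 0 L :=
  extClosure_shiftsOf_self hL (by simp)

lemma IsSimpleMindedCollection.ge_zero {L : D} (hL : L ∈ 𝓛) : h𝓛.tStructure.ge 0 L :=
  extClosure_shiftsOf_self hL (by simp)

/-- The cone of a nonzero morphism `X ⟶ L` with `X ∈ D^{t ≤ 0}` and `L` simple
lies in `D^{t ≤ -1}`. -/
lemma IsSimpleMindedCollection.cone_le {X L : D} (hX : h𝓛.tStructure.le 0 X) (hL : L ∈ 𝓛)
    {f : X ⟶ L} (hf : f ≠ 0) {Z : D} {g : L ⟶ Z} {h : Z ⟶ X⟦(1 : ℤ)⟧}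
    (hT : Triangle.mk f g h ∈ distTriang D) : h𝓛.tStructure.le (-1) Z := by
  induction hX generalizing Z with
  | of X hX =>
    obtain ⟨S, hS, m, hm, ⟨e⟩⟩ := hX
    have hf' := (h𝓛.eq_zero_or_isIso hS hL (b := 0) (by lia) e
      ((shiftFunctorZero D ℤ).app L).symm f).resolve_left hf
    exact .zero _ (((Triangle.mk f g h).isZero₃_iff_isIso₁ hT).2 hf')
  | zero X hX => exact (hf (hX.eq_of_src _ _)).elim
  | ext T hT' hT₁ _ h₁ h₃ =>
    -- If `f` factors as `f'` through `T.obj₃`, the octahedron makes its cone an extension of the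
    -- cone of `f'` by `T.obj₁⟦1⟧`. Otherwise the cone of `f` is an extension of `T.obj₃⟦1⟧` by the
    -- cone of `T.mor₁ ≫ f`.
    by_cases h0 : T.mor₁ ≫ f = 0
    · obtain ⟨f', rfl⟩ := T.yoneda_exact₂ hT' f h0
      have hf' : f' ≠ 0 := fun h => hf (by simp [h])
      obtain ⟨Z', g', h', hT''⟩ := distinguished_cocone_triangle f'
      have o := someOctahedron rfl (rot_of_distTriang _ hT') hT'' hT
      refine extClosure.ext _ o.mem ?_ (h₃ hf' hT'')
      exact h𝓛.tStructure.le_shift 0 1 (-1) (by lia) _ hT₁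
    · obtain ⟨Z', g', h', hT''⟩ := distinguished_cocone_triangle (T.mor₁ ≫ f)
      have o := someOctahedron rfl hT' hT hT''
      refine extClosure.ext _ (rot_of_distTriang _ o.mem) (h₁ h0 hT'') ?_
      exact h𝓛.tStructure.le_shift 0 1 (-1) (by lia) _ (by assumption)

/-- Derived projective objects have the lifting property along nonzero morphisms
from objects of `D^{t ≤ 0}` to simple objects. -/
lemma IsSimpleMindedCollection.exists_lift {P X L : D}
    (hP : IsDerivedProjective h𝓛.tStructure P) (hX : h𝓛.tStructure.le 0 X) (hL : L ∈ 𝓛)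
    {f : X ⟶ L} (hf : f ≠ 0) (g : P ⟶ L) : ∃ a : P ⟶ X, a ≫ f = g := by
  obtain ⟨Z, p, q, hT⟩ := distinguished_cocone_triangle f
  obtain ⟨a, ha⟩ := (Triangle.mk f p q).coyoneda_exact₂ hT g
    (hP.hom_le_eq_zero le_rfl (h𝓛.cone_le hX hL hf hT) _)
  exact ⟨a, ha.symm⟩

/-- A derived projective object with local endomorphism ring has an essentially unique nonzero
morphism to a simple object. -/
lemma IsSimpleMindedCollection.exists_factor {P L L' : D} [IsLocalRing (End P)]
    (hP : IsDerivedProjective h𝓛.tStructure P) (hL : L ∈ 𝓛) (hL' : L' ∈ 𝓛)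
    {f : P ⟶ L} (hf : f ≠ 0) (g : P ⟶ L') : ∃ u : L ⟶ L', f ≫ u = g := by
  obtain ⟨K, k, d, hT⟩ := distinguished_cocone_triangle₁ f
  by_cases hk : k ≫ g = 0
  · obtain ⟨u, hu⟩ := (Triangle.mk k f d).yoneda_exact₂ hT g hk
    exact ⟨u, hu.symm⟩
  · have hK : h𝓛.tStructure.le 0 K := by
      have := h𝓛.cone_le hP.le_zero hL hf (rot_of_distTriang _ hT)
      rw [← h𝓛.tStructure.shift_le 1 (-1) 0 (by lia)]
      exact this
    -- Lifting `g` through `k ≫ g` gives `a ≫ k` fixing `g`, hence invertible, although `k ≫ f = 0`.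
    obtain ⟨a, ha⟩ := h𝓛.exists_lift hP hK hL' hk g
    have hg : g ≠ 0 := fun h => hk (by simp [h])
    have := isIso_of_comp_eq (e := a ≫ k) hg (by simpa using ha)
    refine (hf ?_).elim
    rw [← cancel_epi (a ≫ k), comp_zero, Category.assoc,
      show k ≫ f = 0 from comp_distTriang_mor_zero₁₂ _ hT, comp_zero]

end

end Simple

section Bijection

variable {D : Type u} [Category.{v} D] [Preadditive D] [HasZeroObject D] [HasShift D ℤ]
  [∀ n : ℤ, (shiftFunctor D n).Additive] [Pretriangulated D] [IsTriangulated D]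
  {𝓟 𝓛 : Set D} (h𝓛 : IsSimpleMindedCollection 𝓛)

/-! ### The bijection between `𝓟` and `𝓛` -/

lemma IsSimpleMindedCollection.tStructure_le_shift {L : D} (hL : L ∈ 𝓛) (m : ℤ) :
    h𝓛.tStructure.le (-m) (L⟦m⟧) :=
  h𝓛.tStructure.le_shift 0 m _ (by lia) _ (h𝓛.le_zero hL)

lemma IsSimpleMindedCollection.tStructure_ge_shift {L : D} (hL : L ∈ 𝓛) (m : ℤ) :
    h𝓛.tStructure.ge (-m) (L⟦m⟧) :=
  h𝓛.tStructure.ge_shift 0 m _ (by lia) _ (h𝓛.ge_zero hL)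

lemma IsSimpleMindedCollection.hom_shift_eq_zero_of_isDerivedProjective {P L : D}
    (hP : IsDerivedProjective h𝓛.tStructure P) (hL : L ∈ 𝓛) {m : ℤ} (hm : m ≠ 0)
    (f : P ⟶ L⟦m⟧) : f = 0 := by
  obtain hm | hm := hm.lt_or_gt
  · exact hP.hom_ge_eq_zero (by lia) (h𝓛.tStructure_ge_shift hL m) f
  · exact hP.hom_le_eq_zero (by lia) (h𝓛.tStructure_le_shift hL m) f

lemma IsSimpleMindedCollection.isDerivedProjective_of_hom_shift_eq_zero {P : D}
    (hP : ∀ L ∈ 𝓛, ∀ m : ℤ, m ≠ 0 → ∀ f : P ⟶ L⟦m⟧, f = 0) :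
    IsDerivedProjective h𝓛.tStructure P := by
  have key : ∀ (p : ℤ → Prop), (∀ m, p m → m ≠ 0) →
      extClosure (shiftsOf 𝓛 p) ≤ rightOrthogonal (· = P) := by
    refine fun p hp => extClosure_le ?_
    rintro X ⟨L, hL, m, hm, ⟨e⟩⟩ _ f rfl
    exact hom_eq_zero_of_iso (Iso.refl _) e (hP L hL m (hp m hm)) f
  constructor
  · refine (TStructure.le_iff_isLE _ P 0).2
      ((TStructure.isLE_iff_orthogonal _ 0 1 rfl P).2 fun Y f hY => ?_)
    exact key _ (fun m hm => by lia) _ hY.ge f rfl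
  · intro X hX f
    exact key _ (fun m hm => by lia) _ (h𝓛.tStructure.le_shift 0 1 (-1) (by lia) _ hX) f rfl

/-- Otherwise `P` is left orthogonal to every shift of `𝓛`, hence to all of `D`, and `𝟙 P = 0`. -/
lemma IsSimpleMindedCollection.exists_ne_zero {P : D}
    (hP : IsDerivedProjective h𝓛.tStructure P) (h0 : ¬ IsZero P) :
    ∃ L ∈ 𝓛, ∃ f : P ⟶ L, f ≠ 0 := by
  by_contra! H
  have key : extClosure (shiftsOf 𝓛 (fun _ => True)) ≤ rightOrthogonal (· = P) := by
    refine extClosure_le ?_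
    rintro X ⟨L, hL, m, -, ⟨e⟩⟩ _ f rfl
    refine hom_eq_zero_of_iso (Iso.refl _) e (fun f => ?_) f
    by_cases hm : m = 0
    · subst hm
      exact hom_eq_zero_of_iso (Iso.refl _) ((shiftFunctorZero D ℤ).app L) (H L hL) f
    · exact h𝓛.hom_shift_eq_zero_of_isDerivedProjective hP hL hm f
  exact h0 ((IsZero.iff_id_eq_zero P).2
    (key _ (extClosure_shiftsOf_of_tria (h𝓛.generates P)) (𝟙 P) rfl))

/-- Otherwise the silting description puts `L` in `D^{t ≤ -1}` as well as in `D^{t ≥ 0}`, forcing `𝟙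
L = 0`. -/
lemma IsSimpleMindedCollection.exists_mem_ne_zero
    (h : IsSiltingTStructure 𝓟 h𝓛.tStructure) {L : D} (hL : L ∈ 𝓛) :
    ∃ P ∈ 𝓟, ∃ f : P ⟶ L, f ≠ 0 := by
  by_contra! H
  have hL' : h𝓛.tStructure.le (-1) L := by
    rw [← h𝓛.tStructure.shift_le (-1) 0 (-1) rfl, prop_shift_iff, h.1]
    intro P hP m hm
    refine hom_eq_zero_of_iso (Iso.refl P)
      ((shiftFunctorAdd' D (-1) m (-1 + m) rfl).app L).symm fun f => ?_
    by_cases hm' : -1 + m = 0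
    · revert f
      rw [hm']
      intro f
      exact hom_eq_zero_of_iso (Iso.refl _) ((shiftFunctorZero D ℤ).app L) (H P hP) f
    · exact h𝓛.hom_shift_eq_zero_of_isDerivedProjective (h.isDerivedProjective hP) hL hm' f
  have := (h𝓛.division L hL).1
  exact one_ne_zero (α := End L) (h𝓛.tStructure.zero_of_isLE_of_isGE (𝟙 L) (-1) 0 (by lia)
    ⟨hL'⟩ ⟨h𝓛.ge_zero hL⟩)

variable (h𝓟 : IsSiltingCollection 𝓟)

include h𝓟

/-- The bijection sending `P` to the unique `L ∈ 𝓛` with `Hom(P, L) ≠ 0`. -/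
lemma IsSimpleMindedCollection.exists_equiv (h : IsSiltingTStructure 𝓟 h𝓛.tStructure) :
    ∃ φ : 𝓟 ≃ 𝓛, ∀ P : 𝓟, ∃ f : P.1 ⟶ (φ P).1, f ≠ 0 := by
  have H : ∀ P : 𝓟, ∃ L : 𝓛, ∃ f : P.1 ⟶ L.1, f ≠ 0 := fun P => by
    obtain ⟨L, hL, f, hf⟩ := h𝓛.exists_ne_zero (h.isDerivedProjective P.2)
      (h𝓟.indecomposable _ P.2).1
    exact ⟨⟨L, hL⟩, f, hf⟩
  choose φ f hf using H
  refine ⟨Equiv.ofBijective φ ⟨fun P Q hPQ => ?_, fun L => ?_⟩, fun P => ⟨f P, hf P⟩⟩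
  · have hP := h.isDerivedProjective P.2
    have hQ := h.isDerivedProjective Q.2
    have := h𝓟.isLocalRing P.2
    have := h𝓟.isLocalRing Q.2
    have hg : ∃ g : Q.1 ⟶ (φ P).1, g ≠ 0 := hPQ ▸ ⟨f Q, hf Q⟩
    obtain ⟨g, hg⟩ := hg
    -- The nonzero maps from `P` and `Q` to the same simple lift through each other. Both composites
    -- of the lifts fix a nonzero map, so they are invertible and `P ≅ Q`.
    obtain ⟨a, ha⟩ := h𝓛.exists_lift hP hQ.le_zero (φ P).2 hg (f P)
    obtain ⟨b, hb⟩ := h𝓛.exists_lift hQ hP.le_zero (φ P).2 (hf P) g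
    have h₁ : IsIso (a ≫ b) := isIso_of_comp_eq (hf P) (by rw [Category.assoc, hb, ha])
    have h₂ : IsIso (b ≫ a) := isIso_of_comp_eq hg (by rw [Category.assoc, ha, hb])
    have : IsSplitMono a := ⟨⟨b ≫ inv (a ≫ b), by rw [← Category.assoc, IsIso.hom_inv_id]⟩⟩
    have : Epi a := epi_of_epi b a
    have : IsIso a := isIso_of_epi_of_isSplitMono a
    exact Subtype.ext (h𝓟.pairwise_not_iso _ P.2 _ Q.2 ⟨asIso a⟩)
  · obtain ⟨P, hP, g, hg⟩ := h𝓛.exists_mem_ne_zero h L.2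
    refine ⟨⟨P, hP⟩, ?_⟩
    have := h𝓟.isLocalRing hP
    obtain ⟨u, hu⟩ := h𝓛.exists_factor (h.isDerivedProjective hP) (φ ⟨P, hP⟩).2 L.2
      (hf ⟨P, hP⟩) g
    by_contra hne
    have hu' := h𝓛.hom_ne _ (φ ⟨P, hP⟩).2 _ L.2 (fun h => hne (Subtype.ext h)) u
    exact hg (by rw [← hu, hu', comp_zero])

/-- The isomorphism is the inverse of `u ↦ f ≫ u`: injective since nonzero `u` are invertible,
surjective by `exists_factor`. -/
lemma IsSimpleMindedCollection.isHomDualBijection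
    (h : IsSiltingTStructure 𝓟 h𝓛.tStructure) {φ : 𝓟 ≃ 𝓛}
    (hφ : ∀ P : 𝓟, ∃ f : P.1 ⟶ (φ P).1, f ≠ 0) : IsHomDualBijection φ := by
  constructor
  · intro P
    obtain ⟨f, hf⟩ := hφ P
    have := h𝓟.isLocalRing P.2
    refine ⟨(LinearEquiv.ofBijective (LinearMap.toSpanSingleton (End (φ P).1) _ f)
      ⟨?_, fun g => ?_⟩).symm⟩
    · refine (injective_iff_map_eq_zero _).2 fun u (hu : f ≫ (u : (φ P).1 ⟶ (φ P).1) = 0) => ?_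
      by_contra hu'
      have := h𝓛.isIso_of_ne_zero (φ P).2 (φ P).2 (f := u) hu'
      exact hf (by rw [← cancel_mono (u : (φ P).1 ⟶ (φ P).1), hu, zero_comp])
    · exact h𝓛.exists_factor (h.isDerivedProjective P.2) (φ P).2 (φ P).2 hf g
  · intro P L m hLm g
    by_cases hm : m = 0
    · subst hm
      obtain ⟨f, hf⟩ := hφ P
      have := h𝓟.isLocalRing P.2
      refine hom_eq_zero_of_iso (Iso.refl _) ((shiftFunctorZero D ℤ).app L.1) (fun g => ?_) g
      obtain ⟨u, hu⟩ := h𝓛.exists_factor (h.isDerivedProjective P.2) (φ P).2 L.2 hf g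
      rw [← hu, h𝓛.hom_ne _ (φ P).2 _ L.2 (fun h => hLm ⟨Subtype.ext h.symm, rfl⟩) u, comp_zero]
    · exact h𝓛.hom_shift_eq_zero_of_isDerivedProjective (h.isDerivedProjective P.2) L.2 hm g

end Bijection

section ProjectiveCovers

variable {D : Type u} [Category.{v} D] [Preadditive D] [HasZeroObject D] [HasShift D ℤ]
  [∀ n : ℤ, (shiftFunctor D n).Additive] [Pretriangulated D] [IsTriangulated D]

/-! ### Derived projective covers -/

section

variable (t : TStructure D)

lemma isIso_truncLTι_app (X : D) [t.IsLE X 0] : IsIso ((t.truncLTι 1).app X) :=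
  (t.isLE_iff_isIso_truncLTι_app 0 1 rfl X).1 inferInstance

attribute [local instance] isIso_truncLTι_app

/-- The canonical morphism `X ⟶ H_t^0 X` for `X ∈ D^{t ≤ 0}`. -/
noncomputable def toHeart (X : D) [t.IsLE X 0] : X ⟶ ((heartCohomology t).obj X).obj :=
  inv ((t.truncLTι 1).app X) ≫ (t.truncGEπ 0).app ((t.truncLT 1).obj X)

lemma toHeart_naturality {X Y : D} [t.IsLE X 0] [t.IsLE Y 0] (f : X ⟶ Y) :
    toHeart t X ≫ ((heartCohomology t).map f).hom = f ≫ toHeart t Y := by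
  have h₁ := (t.truncLTι 1).naturality f
  have h₂ := (t.truncGEπ 0).naturality ((t.truncLT 1).map f)
  dsimp at h₁ h₂
  change (inv ((t.truncLTι 1).app X) ≫ (t.truncGEπ 0).app ((t.truncLT 1).obj X)) ≫
    (t.truncGE 0).map ((t.truncLT 1).map f) =
      f ≫ inv ((t.truncLTι 1).app Y) ≫ (t.truncGEπ 0).app ((t.truncLT 1).obj Y)
  rw [Category.assoc, ← h₂, IsIso.inv_comp_eq, ← Category.assoc, ← Category.assoc, ← h₁,
    Category.assoc, Category.assoc, IsIso.hom_inv_id_assoc]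

/-- With the fibre of `toHeart` in `D^{t ≤ -1}`, maps from `X` to `D^{t ≥ 0}` factor uniquely
through `H_t^0 X`, and maps from a derived projective to `H_t^0 X` lift uniquely to `X`. -/
lemma exists_toHeart_triangle (X : D) [t.IsLE X 0] :
    ∃ (N : D) (n : N ⟶ X) (d : ((heartCohomology t).obj X).obj ⟶ N⟦(1 : ℤ)⟧),
      Triangle.mk n (toHeart t X) d ∈ distTriang D ∧ t.le (-1) N := by
  refine ⟨(t.truncLT 0).obj ((t.truncLT 1).obj X),
    (t.truncLTι 0).app ((t.truncLT 1).obj X) ≫ (t.truncLTι 1).app X,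
    (t.truncGEδLT 0).app ((t.truncLT 1).obj X), ?_, (t.isLE_truncLT_obj _ 0 (-1)).le⟩
  let e : (t.truncLT 1).obj X ≅ X :=
    @asIso _ _ _ _ ((t.truncLTι 1).app X) (isIso_truncLTι_app t X)
  refine isomorphic_distinguished _
    (t.triangleLTGE_distinguished 0 ((t.truncLT 1).obj X)) _
    (Triangle.isoMk _ _ (Iso.refl _) e.symm (Iso.refl _) ?_ ?_ ?_)
  · exact (Category.assoc _ _ _).trans ((congrArg (_ ≫ ·) e.hom_inv_id).trans
      ((Category.comp_id _).trans (Category.id_comp _).symm))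
  · exact Category.comp_id _
  · exact (congrArg (_ ≫ ·) ((shiftFunctor D (1 : ℤ)).map_id _)).trans
      ((Category.comp_id _).trans (Category.id_comp _).symm)

lemma toHeart_hom_ext {X Z : D} [t.IsLE X 0] [t.IsGE Z 0]
    {a b : ((heartCohomology t).obj X).obj ⟶ Z} (h : toHeart t X ≫ a = toHeart t X ≫ b) :
    a = b := by
  obtain ⟨N, n, d, hT, hN⟩ := exists_toHeart_triangle t X
  obtain ⟨c, hc⟩ := Triangle.yoneda_exact₃ _ hT (a - b) (by
    change toHeart t X ≫ (a - b) = 0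
    rw [Preadditive.comp_sub, h, sub_self])
  have hc0 : c = 0 := t.zero_of_isLE_of_isGE c (-2) 0 (by lia)
    ⟨t.le_shift (-1) 1 (-2) (by lia) _ hN⟩ inferInstance
  rw [hc0, comp_zero] at hc
  exact sub_eq_zero.1 hc

lemma exists_toHeart_comp_eq {X Z : D} [t.IsLE X 0] [t.IsGE Z 0] (g : X ⟶ Z) :
    ∃ a, toHeart t X ≫ a = g := by
  obtain ⟨N, n, d, hT, hN⟩ := exists_toHeart_triangle t X
  obtain ⟨a, ha⟩ := Triangle.yoneda_exact₂ _ hT g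
    (t.zero_of_isLE_of_isGE (n ≫ g) (-1) 0 (by lia) ⟨hN⟩ inferInstance)
  exact ⟨a, ha.symm⟩

variable {t} in
lemma IsDerivedProjective.exists_comp_toHeart_eq {P X : D} (hP : IsDerivedProjective t P)
    [t.IsLE X 0] (g : P ⟶ ((heartCohomology t).obj X).obj) : ∃ a, a ≫ toHeart t X = g := by
  obtain ⟨N, n, d, hT, hN⟩ := exists_toHeart_triangle t X
  obtain ⟨a, ha⟩ := Triangle.coyoneda_exact₃ _ hT g
    (hP.hom_le_eq_zero (n := -2) (by lia) (t.le_shift (-1) 1 (-2) (by lia) _ hN) _)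
  exact ⟨a, ha.symm⟩

variable {t} in
lemma IsDerivedProjective.eq_zero_of_comp_toHeart_eq_zero {P X : D}
    (hP : IsDerivedProjective t P) [t.IsLE X 0] (a : P ⟶ X) (ha : a ≫ toHeart t X = 0) :
    a = 0 := by
  obtain ⟨N, n, d, hT, hN⟩ := exists_toHeart_triangle t X
  obtain ⟨b, hb⟩ := Triangle.coyoneda_exact₂ _ hT a ha
  rw [hP.hom_le_eq_zero le_rfl hN b] at hb
  exact hb.trans zero_comp

end

variable {𝓟 𝓛 : Set D} (h𝓛 : IsSimpleMindedCollection 𝓛)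

/-- It suffices to test `W` against `L⟦m⟧` with `m ≤ 0`. For `m = 0`, the composite `Z ⟶ W ⟶ L`
vanishes since `g` is epi in the heart, so `W ⟶ L` factors through `Y⟦1⟧` and is zero. -/
lemma IsSimpleMindedCollection.cone_le_of_epi {Y Z : h𝓛.tStructure.heart.FullSubcategory}
    (g : Y ⟶ Z) [Epi g] {W : D} {p : Z.obj ⟶ W} {q : W ⟶ Y.obj⟦(1 : ℤ)⟧}
    (hT : Triangle.mk g.hom p q ∈ distTriang D) : h𝓛.tStructure.le (-1) W := by
  have hY := h𝓛.tStructure.le_shift 0 1 (-1) (by lia) _ Y.property.1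
  have hW : h𝓛.tStructure.le 0 W :=
    (h𝓛.tStructure.isLE₂ _ (rot_of_distTriang _ hT) 0 ⟨Z.property.1⟩
      ⟨h𝓛.tStructure.le_monotone (by lia) _ hY⟩).le
  have key : h𝓛.tStructure.ge 0 ≤ rightOrthogonal (· = W) := by
    refine extClosure_le ?_
    rintro X ⟨L, hL, m, hm, ⟨e⟩⟩ _ f rfl
    refine hom_eq_zero_of_iso (Iso.refl _) e (fun f => ?_) f
    by_cases hm' : m = 0
    · subst hm'
      refine hom_eq_zero_of_iso (Iso.refl _) ((shiftFunctorZero D ℤ).app L) (fun f => ?_) f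
      let L' : h𝓛.tStructure.heart.FullSubcategory := ⟨L, h𝓛.le_zero hL, h𝓛.ge_zero hL⟩
      let c : Z ⟶ L' := homMk (p ≫ f)
      have hc : c = 0 := by
        rw [← cancel_epi g, comp_zero]
        ext
        change g.hom ≫ p ≫ f = 0
        rw [← Category.assoc, show g.hom ≫ p = 0 from comp_distTriang_mor_zero₁₂ _ hT, zero_comp]
      obtain ⟨b, hfb⟩ := Triangle.yoneda_exact₃ _ hT f (congrArg (·.hom) hc)
      have hb : b = 0 := h𝓛.tStructure.zero_of_isLE_of_isGE b (-1) 0 (by lia) ⟨hY⟩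
        ⟨h𝓛.ge_zero hL⟩
      rw [hfb, hb]
      exact comp_zero
    · exact h𝓛.tStructure.zero' f hW
        (h𝓛.tStructure.ge_antitone (by lia) _ (h𝓛.tStructure_ge_shift hL m))
  refine (TStructure.le_iff_isLE _ W (-1)).2
    ((TStructure.isLE_iff_orthogonal _ (-1) 0 rfl W).2 fun Y f hY => ?_)
  exact key _ hY.ge f rfl

lemma IsSimpleMindedCollection.exists_lift_of_epi {P : D}
    (hP : IsDerivedProjective h𝓛.tStructure P) {Y Z : h𝓛.tStructure.heart.FullSubcategory}
    (g : Y ⟶ Z) [Epi g] (f : P ⟶ Z.obj) : ∃ a : P ⟶ Y.obj, a ≫ g.hom = f := by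
  obtain ⟨W, p, q, hT⟩ := distinguished_cocone_triangle g.hom
  obtain ⟨a, ha⟩ := (Triangle.mk g.hom p q).coyoneda_exact₂ hT f
    (hP.hom_le_eq_zero le_rfl (h𝓛.cone_le_of_epi g hT) _)
  exact ⟨a, ha.symm⟩

lemma IsSimpleMindedCollection.isDerivedProjectiveCover {P L : D} [IsLocalRing (End P)]
    (hP : IsDerivedProjective h𝓛.tStructure P) (hL : L ∈ 𝓛) {f : P ⟶ L} (hf : f ≠ 0) :
    IsDerivedProjectiveCover h𝓛.tStructure f := by
  set t := h𝓛.tStructure with ht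
  have : t.IsLE P 0 := ⟨hP.le_zero⟩
  have : t.IsLE L 0 := ⟨h𝓛.le_zero hL⟩
  have hL0 : t.IsGE L 0 := ⟨h𝓛.ge_zero hL⟩
  have hge : ∀ Z : t.heart.FullSubcategory, t.IsGE Z.obj 0 := fun Z => ⟨Z.property.2⟩
  refine ⟨hP, ⟨fun {Y Z} g e _ => ?_⟩, ⟨fun {Z} a b hab => ?_⟩,
    fun Q g _ => ⟨fun {Z} a b hab => ?_⟩⟩
  · obtain ⟨a, ha⟩ := h𝓛.exists_lift_of_epi hP e (toHeart t P ≫ g.hom)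
    obtain ⟨a', ha'⟩ := exists_toHeart_comp_eq t a
    refine ⟨homMk a', ?_⟩
    ext
    apply toHeart_hom_ext t
    change toHeart t P ≫ a' ≫ e.hom = _
    rw [← Category.assoc, ha', ha]
  · ext
    apply toHeart_hom_ext t
    obtain ⟨W, p, q, hT⟩ := distinguished_cocone_triangle f
    have hW := h𝓛.cone_le hP.le_zero hL hf hT
    have hab' : ((heartCohomology t).map f).hom ≫ a.hom =
      ((heartCohomology t).map f).hom ≫ b.hom := congrArg (·.hom) hab
    have h0 : f ≫ (toHeart t L ≫ a.hom - toHeart t L ≫ b.hom) = 0 := by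
      rw [Preadditive.comp_sub, ← Category.assoc, ← Category.assoc, ← toHeart_naturality,
        Category.assoc, Category.assoc, hab', sub_self]
    obtain ⟨c, hc⟩ := (Triangle.mk f p q).yoneda_exact₂ hT _ h0
    have hc0 : c = 0 := t.zero_of_isLE_of_isGE c (-1) 0 (by lia) ⟨hW⟩ (hge Z)
    rw [hc0, comp_zero] at hc
    exact sub_eq_zero.1 hc
  -- Essentiality: lift `f` followed by `toHeart` to `s : P ⟶ Q`, then lift `s ≫ g` to an
  -- endomorphism `e` of `P`. It fixes `f`, so it is invertible, and a map killed by `g` is killed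
  -- by `e ≫ toHeart t P`.
  · obtain ⟨s, hs⟩ := h𝓛.exists_lift_of_epi hP (g ≫ (heartCohomology t).map f)
      (f ≫ toHeart t L)
    obtain ⟨e, he⟩ := hP.exists_comp_toHeart_eq (s ≫ g.hom)
    have hef : e ≫ f = f := by
      refine sub_eq_zero.1 (hP.eq_zero_of_comp_toHeart_eq_zero _ ?_)
      rw [Preadditive.sub_comp, ← hs, Category.assoc, ← toHeart_naturality, ← Category.assoc, he,
        Category.assoc]
      exact sub_self _
    have := isIso_of_comp_eq hf hef
    ext
    apply toHeart_hom_ext t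
    rw [← cancel_epi e, ← Category.assoc, ← Category.assoc, he, Category.assoc, Category.assoc]
    exact congrArg (s ≫ ·) (congrArg (·.hom) hab)

end ProjectiveCovers

end SiltingTheory

/-! ### The main theorem -/

open SiltingTheory in
theorem mainTheorem3 {D : Type u} [Category.{v} D] [Preadditive D] [HasZeroObject D]
    [HasShift D ℤ] [∀ n : ℤ, (shiftFunctor D n).Additive] [Pretriangulated D]
    [IsTriangulated D] (𝓟 𝓛 : Set D)
    (h𝓟 : IsSiltingCollection 𝓟) (h𝓛 : IsSimpleMindedCollection 𝓛) :
    ∃ (w : WeightStructure (thick 𝓟).FullSubcategory) (t : TStructure D),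
      IsWeightStructureOf 𝓟 w ∧ IsTStructureOf 𝓛 t ∧
      List.TFAE [
        IsLeftOrthogonal w t,
        IsWTStrictlyLeftOrthogonal w t,
        IsSiltingTStructure 𝓟 t,
        ∃ φ : 𝓟 ≃ 𝓛, IsDerivedProjectiveCoverBijection t φ,
        ∃ φ : 𝓟 ≃ 𝓛, IsHomDualBijection φ] := by
  obtain ⟨w, hw⟩ := h𝓟.exists_weightStructure
  obtain ⟨t', ht'⟩ := h𝓟.exists_tStructure
  have hdp : (∀ P ∈ 𝓟, IsDerivedProjective h𝓛.tStructure P) →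
      IsSiltingTStructure 𝓟 h𝓛.tStructure :=
    isSiltingTStructure_of_isDerivedProjective ht'
  refine ⟨w, h𝓛.tStructure, hw, h𝓛.isTStructureOf, ?_⟩
  tfae_have 2 → 1 := fun h => h.1
  tfae_have 1 → 3 := fun h => hdp fun _ hP => isDerivedProjective_of_isLeftOrthogonal hw h hP
  tfae_have 3 → 2 := fun h => isWTStrictlyLeftOrthogonal_of_isSiltingTStructure hw h
  tfae_have 3 → 4 := fun h => by
    obtain ⟨φ, hφ⟩ := h𝓛.exists_equiv h𝓟 h
    refine ⟨φ, fun P => ?_⟩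
    obtain ⟨f, hf⟩ := hφ P
    have := h𝓟.isLocalRing P.2
    exact ⟨f, h𝓛.isDerivedProjectiveCover (h.isDerivedProjective P.2) (φ P).2 hf⟩
  tfae_have 4 → 3 := fun ⟨φ, hφ⟩ => hdp fun P hP => (hφ ⟨P, hP⟩).choose_spec.derivedProjective
  tfae_have 3 → 5 := fun h => by
    obtain ⟨φ, hφ⟩ := h𝓛.exists_equiv h𝓟 h
    exact ⟨φ, h𝓛.isHomDualBijection h𝓟 h hφ⟩
  tfae_have 5 → 3 := fun ⟨φ, hφ⟩ => hdp fun P hP =>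
    h𝓛.isDerivedProjective_of_hom_shift_eq_zero fun L hL m hm =>
      hφ.2 ⟨P, hP⟩ ⟨L, hL⟩ m fun h => hm h.2
  tfae_finish
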